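/- Let $n\ge 1$. Let $(a_{\mathbf j})_{\mathbf j\in\mathbb Z_+^n}$ and $(b^{(k)}_{\mathbf j})_{\mathbf j\in\mathbb Z_+^n}$, $k=1,\dots,n$, be real numbers with $a_{\mathbf j}\ge 0$ for $\mathbf j\ne\mathbf 0$, $0<\sum_{\mathbf j\neq\mathbf 0}a_{\mathbf j}=-a_{\mathbf 0}<\infty$, $b^{(k)}_{\mathbf j}\ge 0$ for $\mathbf j\ne\mathbf e_k$, and $0<\sum_{\mathbf j\ne\mathbf e_k}b^{(k)}_{\mathbf j}=-b^{(k)}_{\mathbf e_k}<\infty$. The $n$-type branching process with immigration absorbed at $\mathbf 0$ has the $q$-matrix $Q$ on $\mathbb Z_+^n$ with $q_{\mathbf 0\mathbf j}=0$ for all $\mathbf j$ and, for $\mathbf i\neq\mathbf 0$, $$q_{\mathbf i\mathbf j}=\sum_{k=1}^n i_k\,b^{(k)}_{\mathbf j-\mathbf i+\mathbf e_k}+a_{\mathbf j-\mathbf i},$$ where terms whose index is not in $\mathbb Z_+^n$ are omitted. Let $(p_{\mathbf i\mathbf j}(t))$ be the Feller minimal $Q$-function and $a_{\mathbf i0}=\lim_{t\to\infty}p_{\mathbf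 i\mathbf 0}(t)$ the extinction probability from $\mathbf i$. For $u\in[0,1]^n$ put $A(u)=\sum_{\mathbf j}a_{\mathbf j}u^{\mathbf j}$, $B_k(u)=\sum_{\mathbf j}b^{(k)}_{\mathbf j}u^{\mathbf j}$ (with $u^{\mathbf j}=u_1^{j_1}\cdots u_n^{j_n}$, $0^0=1$), and $B_{ij}=\partial B_i/\partial u_j$. Assume: * there is no matrix $M$ with $(B_1(u),\dots,B_n(u))^{T}=Mu$ for all $u\in[0,1]^n$; * $B_{ij}(\mathbf 1)<\infty$ for all $i,j$; * the nonnegative matrix $\bigl(\delta_{ij}-B_{ij}(\mathbf 1)/b^{(i)}_{\mathbf e_i}\bigr)$ has a power $N\ge 1$ with all entries positive; * $B_1(\mathbf 0)>0$. Let $\rho$ be the maximal eigenvalue of $(B_{ij}(\mathbf 1))$. **Theorem 3.2.** The limits $a_{\mathbf i0}$ exist. The system $B_1=\dots=B_n=0$ has a smallest solution $\mathbf q=(q_1,\dots,q_n)$ in $[0,1]^n$ (componentwise). There is a unique continuous curve $c(u)=(u,u_2(u),\dots,u_n(u))\in[0,1]^n$, $u\in[0,q_1]$, such that for $2\le k\le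 n$ one has $u_k(0)=0$ and $u_k'(u)=B_k(c(u))/B_1(c(u))$ on $[0,q_1)$, with $B_1(c(u))\neq0$ there. If $\rho\le0$, then $\mathbf q=\mathbf 1$. For $0<r\le q_1$ and $\mathbf i\in\mathbb Z_+^n$ put $$I_r(\mathbf i)=\int_0^{r}\frac{c(y)^{\mathbf i}}{B_1(c(y))}\exp\Bigl(\int_0^y\frac{A(c(x))}{B_1(c(x))}\,dx\Bigr)dy\in[0,\infty],$$ and, when $\rho\le 0$, $J=I_1(\mathbf 0)$. Then, for every $\mathbf i\ne\mathbf 0$, $a_{\mathbf i0}=1$ if and only if $\rho\le 0$ and $J=\infty$. More specifically: (i) If $\rho\le0$ and $J=\infty$, then $a_{\mathbf i0}=1$ for all $\mathbf i\neq\mathbf 0$. (ii) If $\rho\le0$ and $J<\infty$, then $a_{\mathbf i0}=I_1(\mathbf i)/I_1(\mathbf 0)<1$ for all $\mathbf i\neq\mathbf 0$. (iii) If $\rho>0$, then $\mathbf q=c(q_1)$, $q_k<1$ for all $k$, $I_{q_1}(\mathbf 0)<\infty$, and for all $\mathbf i\neq\mathbf 0$ $$a_{\mathbf i0}=\frac{I_{q_1}(\mathbf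 i)}{I_{q_1}(\mathbf 0)}\le\prod_{k=1}^nq_k^{i_k}<1,$$ where the first inequality is strict whenever $\prod_k q_k^{i_k}>0$. If moreover the nonzero states form a single communicating class for $Q$, then $q_k>0$ for all $k$, so that the first inequality is strict for every $\mathbf i\ne\mathbf 0$. -/

import Mathlib

open Set Filter Topology MeasureTheory
open scoped ENNReal

namespace NTBIP

noncomputable section

/-- Immigration rates `a` and branching rates `b k` (for a particle of type `k`) of an `n`-type
branching process with immigration: nonnegative off the diagonal index (`0` for `a`, the `k`-th
unit vector for `b k`), with positive finite off-diagonal sum equal to minus the diagonal entry. -/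
structure Rates (n : ℕ) where
  a : (Fin n → ℕ) → ℝ
  b : Fin n → (Fin n → ℕ) → ℝ
  a_nonneg : ∀ j, j ≠ 0 → 0 ≤ a j
  a_hasSum : HasSum (fun j : {j : Fin n → ℕ // j ≠ 0} => a j) (-a 0)
  a_pos : 0 < -a 0
  b_nonneg : ∀ k j, j ≠ Pi.single k 1 → 0 ≤ b k j
  b_hasSum : ∀ k, HasSum (fun j : {j : Fin n → ℕ // j ≠ Pi.single k 1} => b k j)
    (-b k (Pi.single k 1))
  b_pos : ∀ k, 0 < -b k (Pi.single k 1)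

/-- The monomial `u₁^{m₁} ⋯ uₙ^{mₙ}` (with `0 ^ 0 = 1`). -/
def monomial {n : ℕ} (m : Fin n → ℕ) (u : Fin n → ℝ) : ℝ := ∏ k, u k ^ m k

/-- The generating function of a family of real coefficients. -/
def genFun {n : ℕ} (f : (Fin n → ℕ) → ℝ) (u : Fin n → ℝ) : ℝ := ∑' m, f m * monomial m u

/-- The partial derivative of `genFun f` in the `l`-th variable, as the termwise differentiated
power series (on the boundary of the unit cube this is the one-sided derivative). -/
def genFunDeriv {n : ℕ} (f : (Fin n → ℕ) → ℝ) (l : Fin n) (u : Fin n → ℝ) : ℝ :=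
  ∑' m, f m * ((m l : ℝ) * monomial (m - Pi.single l 1) u)

namespace Rates

variable {n : ℕ} (R : Rates n)

/-- `A(u)`. -/
def A (u : Fin n → ℝ) : ℝ := genFun R.a u

/-- `B_k(u)`. -/
def B (k : Fin n) (u : Fin n → ℝ) : ℝ := genFun (R.b k) u

/-- The matrix `(B_{ij}(u))` of the partial derivatives `∂ B_i / ∂ u_j`. -/
def derivMatrix (u : Fin n → ℝ) : Matrix (Fin n) (Fin n) ℝ :=
  Matrix.of fun i j => genFunDeriv (R.b i) j u

/-- The matrix `(g_{ij}(u))`, `g_{ij} = δ_{ij} - B_{ij} / b^{(i)}_{e_i}`. -/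
def meanMatrix (u : Fin n → ℝ) : Matrix (Fin n) (Fin n) ℝ :=
  Matrix.of fun i j => (if i = j then 1 else 0) - R.derivMatrix u i j / R.b i (Pi.single i 1)

/-- `ρ(u)`: the maximal (real) eigenvalue of `(B_{ij}(u))`. -/
def rho (u : Fin n → ℝ) : ℝ := sSup (spectrum ℝ (R.derivMatrix u))

/-- The system `B_1, …, B_n` is singular: it is a linear map on the unit cube. -/
def Singular : Prop :=
  ∃ M : Matrix (Fin n) (Fin n) ℝ, ∀ u ∈ Icc (0 : Fin n → ℝ) 1, ∀ k, R.B k u = M.mulVec u k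

/-- All partial derivatives `B_{ij}(1, …, 1)` are finite. -/
def FiniteMeans : Prop := ∀ i j, Summable fun m : Fin n → ℕ => R.b i m * (m j : ℝ)

/-- The zeros of the system `B_1 = ⋯ = B_n = 0` in the unit cube `[0,1]^n`. -/
def zeros : Set (Fin n → ℝ) := {u | u ∈ Icc (0 : Fin n → ℝ) 1 ∧ ∀ k, R.B k u = 0}

open Classical in
/-- The absorbing `q`-matrix: no rate out of the empty state `0`, and from `i ≠ 0` to `j` the rate
`∑ k, i_k b^{(k)}_{j - i + e_k} + a_{j - i}`, where a term is omitted if its multi-index has a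
negative component. -/
def qMatrix (i j : Fin n → ℕ) : ℝ :=
  if i = 0 then 0 else
    (∑ k, (i k : ℝ) * if i ≤ j + Pi.single k 1 then R.b k (j + Pi.single k 1 - i) else 0)
      + if i ≤ j then R.a (j - i) else 0

/-- The nonzero states form one communicating class of the absorbing `q`-matrix. -/
def NonzeroStatesIrreducible : Prop :=
  ∀ i j : Fin n → ℕ, i ≠ 0 → j ≠ 0 → Relation.ReflTransGen (fun x y => 0 < R.qMatrix x y) i j

end Rates

open Classical in
/-- The iterates of the backward integral recursion of a `q`-matrix `Q`, started at zero:
`p⁽ᵐ⁺¹⁾_{ij}(t) = δ_{ij} e^{q_{ii} t} + ∫₀ᵗ e^{q_{ii} s} ∑_{k ≠ i} q_{ik} p⁽ᵐ⁾_{kj}(t - s) ds`. -/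
def fellerIter {I : Type} (Q : I → I → ℝ) : ℕ → ℝ → I → I → ℝ≥0∞
  | 0, _, _, _ => 0
  | m + 1, t, i, j =>
      (if i = j then ENNReal.ofReal (Real.exp (Q i i * t)) else 0) +
        ∫⁻ s in Icc 0 t, ENNReal.ofReal (Real.exp (Q i i * s)) *
          ∑' k, (if k = i then 0 else ENNReal.ofReal (Q i k)) * fellerIter Q m (t - s) k j

/-- The Feller minimal `Q`-function `p_{ij}(t)`, `t ≥ 0`: the increasing limit of the iterates of
the backward integral recursion. -/
def fellerMinimal {I : Type} (Q : I → I → ℝ) (t : ℝ) (i j : I) : ℝ≥0∞ :=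
  ⨆ m, fellerIter Q m t i j

namespace Rates

variable {n : ℕ} [NeZero n] (R : Rates n)

/-- `c(u) = (u, u_2(u), …, u_n(u))`, `0 ≤ u ≤ r`, is a curve in the unit cube, where
`(u_2, …, u_n)` is continuous on `[0,r]` and solves on `[0,r)` the system
`u_k' = B_k(c(u)) / B_1(c(u))`, `u_k(0) = 0`; the right-hand side is required to be defined.
The first type is the index `0`. -/
structure IsCurve (r : ℝ) (c : ℝ → Fin n → ℝ) : Prop where
  first : ∀ u ∈ Icc 0 r, c u 0 = u
  mem_cube : ∀ u ∈ Icc 0 r, c u ∈ Icc (0 : Fin n → ℝ) 1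
  continuousOn : ContinuousOn c (Icc 0 r)
  initial : ∀ k, k ≠ 0 → c 0 k = 0
  ne_zero : ∀ u ∈ Ico 0 r, R.B 0 (c u) ≠ 0
  ode : ∀ u ∈ Ico 0 r, ∀ k, k ≠ 0 →
    HasDerivWithinAt (fun v => c v k) (R.B k (c u) / R.B 0 (c u)) (Icc 0 r) u

/-- `∫₀ʳ c(y)^i / B_1(c(y)) · exp (∫₀ʸ A(c(x)) / B_1(c(x)) dx) dy`, as an integral with values in
`[0, ∞]` (the integrand is nonnegative along the curve). -/
def curveIntegral (c : ℝ → Fin n → ℝ) (r : ℝ) (i : Fin n → ℕ) : ℝ≥0∞ :=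
  ∫⁻ y in Ico 0 r, ENNReal.ofReal
    (monomial i (c y) / R.B 0 (c y) * Real.exp (∫ x in (0 : ℝ)..y, R.A (c x) / R.B 0 (c x)))

/-- `J`. -/
def J (c : ℝ → Fin n → ℝ) : ℝ≥0∞ := R.curveIntegral c 1 0

end Rates

end

end NTBIP

namespace NTBIP

noncomputable section

/-! ### Monomials and generating functions on the unit cube -/

section PowerSeries

variable {n : ℕ}

/-! Let `V` solve `V' = B(V)`, `V(0) = 0`, and put `E(t) = exp ∫₀ᵗ A(V(s)) ds`. For `i ≠ 0` the
generating function of row `i` of the `q`-matrix turns the backward operator into a time derivative: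
`∑_j q_ij V^j E = (V^i E)'`. Hence `K_T(i) = ∫₀ᵀ V^i E dt` satisfies `∑_j q_ij K_T(j) = V(T)^i
E(T)`, the boundary term at time `0` vanishing because `V(0) = 0`
(`hasSum_qMatrix_mul_flowIntegral`).

So `K_T / K_T(0)` is a subsolution of the backward system with value `1` at the empty state, and it
is at most `V(T)^i`, which is small for large `i` since all components of `V(T)` are below `1`. The
maximum principle `nonpos_of_subsolution` places it below the extinction probability for every
finite `T`. Conversely, the extinction probability lies below every nonnegative supersolution that
is at least `1` at the empty state (`absorption_le`). If `K_∞(0) < ∞`, then `E(T) → 0`, the limiting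
ratio is an exact solution, and the two bounds meet (`extinction_eq_div`). If `K_∞(0) = ∞` and `V →
1`, the ratios tend to `1` and extinction is certain (`extinction_eq_one`).

The flow is monotone and its limit `q` is the smallest zero; it even lies below every point where
all `B_k ≤ 0` (`exists_isLeast_zeros`). The sign of `ρ` locates `q`. For `ρ ≤ 0`, testing against a
positive left Perron vector excludes all zeros but `1` (`eq_one_of_rho_nonpos`). For `ρ > 0`, moving
inwards from `1` along a positive expanding vector reaches a point with all `B_k ≤ 0`
(`exists_B_neg`), so `q < 1` in every component; then `A(q) < 0` makes `E` decay exponentially and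
`K_∞(0)` is finite.

Along the flow the first coordinate has positive speed, so it can replace time. The reparametrised
flow is the curve `c`, and substitution identifies the two kinds of integrals (`curveIntegral_eq`).
Uniqueness of `c` is ODE uniqueness away from the zeros of the denominator (`IsCurve.eqOn`). -/

lemma monomial_zero_left (u : Fin n → ℝ) : monomial 0 u = 1 := by simp [monomial]

lemma monomial_one_right (m : Fin n → ℕ) : monomial m 1 = 1 := by simp [monomial]

lemma monomial_add (m m' : Fin n → ℕ) (u : Fin n → ℝ) :
    monomial (m + m') u = monomial m u * monomial m' u := by
  simp [monomial, pow_add, Finset.prod_mul_distrib]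

lemma monomial_single (k : Fin n) (u : Fin n → ℝ) : monomial (Pi.single k 1) u = u k := by
  rw [monomial, Finset.prod_eq_single k] <;> simp +contextual

lemma monomial_zero_right {m : Fin n → ℕ} (hm : m ≠ 0) : monomial m 0 = 0 := by
  obtain ⟨k, hk⟩ := Function.ne_iff.1 hm
  exact Finset.prod_eq_zero (Finset.mem_univ k) (by simpa using hk)

lemma monomial_nonneg (m : Fin n → ℕ) {u : Fin n → ℝ} (hu : 0 ≤ u) : 0 ≤ monomial m u :=
  Finset.prod_nonneg fun k _ => pow_nonneg (hu k) _

lemma monomial_mono (m : Fin n → ℕ) {u v : Fin n → ℝ} (hu : 0 ≤ u) (huv : u ≤ v) :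
    monomial m u ≤ monomial m v :=
  Finset.prod_le_prod (fun k _ => pow_nonneg (hu k) _)
    fun k _ => pow_le_pow_left₀ (hu k) (huv k) _

lemma monomial_le_one (m : Fin n → ℕ) {u : Fin n → ℝ} (hu : u ∈ Icc (0 : Fin n → ℝ) 1) :
    monomial m u ≤ 1 :=
  (monomial_mono m hu.1 hu.2).trans_eq (monomial_one_right m)

lemma continuous_monomial (m : Fin n → ℕ) : Continuous (monomial m) := by
  unfold monomial; fun_prop

lemma monomial_le_pow (m : Fin n → ℕ) {u : Fin n → ℝ} (hu : u ∈ Icc (0 : Fin n → ℝ) 1)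
    (k : Fin n) : monomial m u ≤ u k ^ m k := by
  classical
  rw [monomial, ← Finset.mul_prod_erase _ _ (Finset.mem_univ k)]
  refine mul_le_of_le_one_right (pow_nonneg (hu.1 k) _) (Finset.prod_le_one ?_ ?_)
  · exact fun l _ => pow_nonneg (hu.1 l) _
  · exact fun l _ => pow_le_one₀ (hu.1 l) (hu.2 l)

lemma monomial_lt_one {m : Fin n → ℕ} (hm : m ≠ 0) {u : Fin n → ℝ} (hu : 0 ≤ u)
    (hu1 : ∀ k, u k < 1) : monomial m u < 1 := by
  obtain ⟨k, hk⟩ := Function.ne_iff.1 hm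
  exact (monomial_le_pow m ⟨hu, fun k => (hu1 k).le⟩ k).trans_lt
    (pow_lt_one₀ (hu k) (hu1 k) (by simpa using hk))

lemma abs_pow_sub_pow_le_mul {x y : ℝ} (hx : x ∈ Icc (0 : ℝ) 1) (hy : y ∈ Icc (0 : ℝ) 1) (m : ℕ) :
    |x ^ m - y ^ m| ≤ m * |x - y| := by
  induction m with
  | zero => simp
  | succ m ih =>
    have h : x ^ (m + 1) - y ^ (m + 1) = x ^ m * (x - y) + (x ^ m - y ^ m) * y := by ring
    rw [h]
    refine (abs_add_le _ _).trans ?_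
    rw [abs_mul, abs_mul, abs_of_nonneg (pow_nonneg hx.1 m), abs_of_nonneg hy.1]
    have h1 : x ^ m * |x - y| ≤ |x - y| :=
      mul_le_of_le_one_left (abs_nonneg _) (pow_le_one₀ hx.1 hx.2)
    have h2 : |x ^ m - y ^ m| * y ≤ |x ^ m - y ^ m| := mul_le_of_le_one_right (abs_nonneg _) hy.2
    push_cast
    linarith

/-- Telescoping: the factors are exchanged one at a time while the others stay in `[0,1]`. -/
lemma abs_prod_sub_prod_le {ι : Type*} (s : Finset ι) {x y : ι → ℝ}
    (hx : ∀ k, x k ∈ Icc (0 : ℝ) 1) (hy : ∀ k, y k ∈ Icc (0 : ℝ) 1) :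
    |∏ k ∈ s, x k - ∏ k ∈ s, y k| ≤ ∑ k ∈ s, |x k - y k| := by
  classical
  induction s using Finset.induction_on with
  | empty => simp
  | insert a s ha ih =>
    rw [Finset.prod_insert ha, Finset.prod_insert ha, Finset.sum_insert ha]
    have h : x a * ∏ k ∈ s, x k - y a * ∏ k ∈ s, y k
        = (∏ k ∈ s, x k) * (x a - y a) + y a * (∏ k ∈ s, x k - ∏ k ∈ s, y k) := by ring
    rw [h]
    refine (abs_add_le _ _).trans (add_le_add ?_ ?_)
    · rw [abs_mul, abs_of_nonneg (Finset.prod_nonneg fun k _ => (hx k).1)]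
      exact mul_le_of_le_one_left (abs_nonneg _)
        (Finset.prod_le_one (fun k _ => (hx k).1) fun k _ => (hx k).2)
    · rw [abs_mul, abs_of_nonneg (hy a).1]
      exact (mul_le_of_le_one_left (abs_nonneg _) (hy a).2).trans ih

/-- The common source of the Lipschitz bound for `B_k`, of the Bernoulli inequality, and of the
domination of difference quotients at `1`. The weights `m l` are what finite means control. -/
lemma abs_monomial_sub_le (m : Fin n → ℕ) {u v : Fin n → ℝ} (hu : u ∈ Icc (0 : Fin n → ℝ) 1)
    (hv : v ∈ Icc (0 : Fin n → ℝ) 1) :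
    |monomial m u - monomial m v| ≤ ∑ l, (m l : ℝ) * |u l - v l| := by
  refine (abs_prod_sub_prod_le _ (fun k => ?_) (fun k => ?_)).trans
    (Finset.sum_le_sum fun l _ => abs_pow_sub_pow_le_mul ⟨hu.1 l, hu.2 l⟩ ⟨hv.1 l, hv.2 l⟩ _)
  · exact ⟨pow_nonneg (hu.1 k) _, pow_le_one₀ (hu.1 k) (hu.2 k)⟩
  · exact ⟨pow_nonneg (hv.1 k) _, pow_le_one₀ (hv.1 k) (hv.2 k)⟩

/-- The Bernoulli inequality `∏ (1 - x_l) ^ m_l ≥ 1 - ∑ m_l x_l`. -/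
lemma one_sub_sum_le_monomial (m : Fin n → ℕ) {x : Fin n → ℝ} (hx : x ∈ Icc (0 : Fin n → ℝ) 1) :
    1 - ∑ l, (m l : ℝ) * x l ≤ monomial m (1 - x) := by
  have h := abs_monomial_sub_le m (u := 1) (v := 1 - x) ⟨zero_le_one, le_rfl⟩
    ⟨sub_nonneg.2 hx.2, by simpa using hx.1⟩
  rw [monomial_one_right] at h
  have h2 : ∑ l, (m l : ℝ) * |(1 : Fin n → ℝ) l - (1 - x) l| = ∑ l, (m l : ℝ) * x l :=
    Finset.sum_congr rfl fun l _ => by simp [abs_of_nonneg (hx.1 l)]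
  rw [h2] at h
  linarith [le_abs_self (1 - monomial m (1 - x))]

/-- After one factor `1 - x_k` is split off, the Bernoulli inequality for the rest leaves the cross
term `x_k ∑ m'_l x_l`, which is positive because the total degree is at least two. -/
lemma one_sub_sum_lt_monomial {m : Fin n → ℕ} {x : Fin n → ℝ} (hx : x ∈ Icc (0 : Fin n → ℝ) 1)
    (hx0 : ∀ l, 0 < x l) (hm : 2 ≤ ∑ l, m l) :
    1 - ∑ l, (m l : ℝ) * x l < monomial m (1 - x) := by
  classical
  obtain ⟨k, hk⟩ : ∃ k, m k ≠ 0 := by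
    by_contra! h
    simp [h] at hm
  obtain ⟨m', rfl⟩ : ∃ m', m = m' + Pi.single k 1 := by
    refine ⟨m - Pi.single k 1, (tsub_add_cancel_of_le ?_).symm⟩
    intro l
    by_cases h : l = k
    · subst h; simp; omega
    · simp [h]
  have hm' : ∃ l, m' l ≠ 0 := by
    by_contra! h
    simp [h] at hm
  obtain ⟨l, hl⟩ := hm'
  have hpos : 0 < ∑ l, (m' l : ℝ) * x l :=
    Finset.sum_pos' (fun l _ => mul_nonneg (Nat.cast_nonneg _) (hx0 l).le)
      ⟨l, Finset.mem_univ l, mul_pos (by positivity) (hx0 l)⟩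
  have hsum : ∑ l, ((m' + Pi.single k 1 : Fin n → ℕ) l : ℝ) * x l =
      ∑ l, (m' l : ℝ) * x l + x k := by
    simp only [Pi.add_apply, Nat.cast_add, add_mul, Finset.sum_add_distrib]
    congr 1
    rw [Finset.sum_eq_single k] <;> simp +contextual
  have hb := one_sub_sum_le_monomial m' hx
  rw [monomial_add, monomial_single]
  push_cast [Pi.add_apply] at hsum ⊢
  rw [hsum]
  have h1 : (1 - x) k = 1 - x k := rfl
  rw [h1]
  have := mul_le_mul_of_nonneg_right hb (sub_nonneg.2 (hx.2 k))
  simp only [Pi.one_apply] at this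
  nlinarith [mul_pos hpos (hx0 k)]

lemma summable_mul_monomial {f : (Fin n → ℕ) → ℝ} (hf : Summable f) {u : Fin n → ℝ}
    (hu : u ∈ Icc (0 : Fin n → ℝ) 1) : Summable fun m => f m * monomial m u := by
  refine Summable.of_norm_bounded hf.norm fun m => ?_
  rw [norm_mul, Real.norm_of_nonneg (monomial_nonneg m hu.1)]
  exact mul_le_of_le_one_right (norm_nonneg _) (monomial_le_one m hu)

lemma continuousOn_genFun {f : (Fin n → ℕ) → ℝ} (hf : Summable f) :
    ContinuousOn (genFun f) (Icc 0 1) := by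
  refine continuousOn_tsum (fun m => ((continuous_monomial m).const_mul _).continuousOn) hf.norm
    fun m u hu => ?_
  rw [norm_mul, Real.norm_of_nonneg (monomial_nonneg m hu.1)]
  exact mul_le_of_le_one_right (norm_nonneg _) (monomial_le_one m hu)

lemma genFun_nonneg {f : (Fin n → ℕ) → ℝ} (hf : ∀ m, 0 ≤ f m) {u : Fin n → ℝ} (hu : 0 ≤ u) :
    0 ≤ genFun f u :=
  tsum_nonneg fun m => mul_nonneg (hf m) (monomial_nonneg m hu)

lemma genFun_mono {f : (Fin n → ℕ) → ℝ} (hf0 : ∀ m, 0 ≤ f m) (hf : Summable f)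
    {u v : Fin n → ℝ} (hu : 0 ≤ u) (huv : u ≤ v) (hv : v ≤ 1) : genFun f u ≤ genFun f v :=
  (summable_mul_monomial hf ⟨hu, huv.trans hv⟩).tsum_le_tsum
    (fun m => mul_le_mul_of_nonneg_left (monomial_mono m hu huv) (hf0 m))
    (summable_mul_monomial hf ⟨hu.trans huv, hv⟩)

lemma genFun_one (f : (Fin n → ℕ) → ℝ) : genFun f 1 = ∑' m, f m := by
  simp [genFun, monomial_one_right]

lemma genFun_zero (f : (Fin n → ℕ) → ℝ) : genFun f 0 = f 0 := by
  rw [genFun, tsum_eq_single 0]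
  · simp [monomial_zero_left]
  · intro m hm
    rw [monomial_zero_right hm, mul_zero]

/-- Passing from a sum over all indices but one to the sum over all indices. -/
lemma hasSum_update_zero {ι : Type*} [DecidableEq ι] {f : ι → ℝ} {e : ι} {s : ℝ}
    (h : HasSum (fun j : {j : ι // j ≠ e} => f j) s) : HasSum (Function.update f e 0) s := by
  have h1 : (fun j : {j : ι // j ≠ e} => f j)
      = Function.update f e 0 ∘ ((↑) : {j : ι // j ≠ e} → ι) := by
    funext j
    simp [j.2]
  rw [h1] at h
  refine (Function.Injective.hasSum_iff Subtype.val_injective ?_).1 h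
  intro x hx
  have : x = e := by
    by_contra hne
    exact hx ⟨⟨x, hne⟩, rfl⟩
  simp [this]

lemma hasSum_of_hasSum_ne {ι : Type*} {f : ι → ℝ} {e : ι} {s : ℝ}
    (h : HasSum (fun j : {j : ι // j ≠ e} => f j) s) : HasSum f (s + f e) := by
  classical
  convert (hasSum_update_zero h).add (hasSum_ite_eq e (f e)) using 1
  funext j
  by_cases hj : j = e
  · subst hj; simp
  · simp [hj]

lemma genFun_eq_update_add {f : (Fin n → ℕ) → ℝ} (hf : Summable f) (e : Fin n → ℕ) {u : Fin n → ℝ}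
    (hu : u ∈ Icc (0 : Fin n → ℝ) 1) :
    genFun f u = genFun (Function.update f e 0) u + f e * monomial e u := by
  have h := (summable_mul_monomial hf hu).hasSum
  have h2 := h.sub (hasSum_ite_eq e (f e * monomial e u))
  have h3 : (fun m => f m * monomial m u - if m = e then f e * monomial e u else 0)
      = fun m => Function.update f e 0 m * monomial m u := by
    funext m
    by_cases hm : m = e
    · subst hm; simp
    · simp [hm]
  rw [h3] at h2
  rw [genFun, genFun, h2.tsum_eq]
  ring

end PowerSeries

namespace Rates

variable {n : ℕ} (R : Rates n)

/-! ### The generating functions `A` and `B_k` -/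

/-- The rates `b^{(k)}_j`, `j ≠ e_k`, extended by zero to `j = e_k`. -/
def bOff (k : Fin n) : (Fin n → ℕ) → ℝ := Function.update (R.b k) (Pi.single k 1) 0

/-- The total rate `-b^{(k)}_{e_k}` at which a particle of type `k` branches. -/
def beta (k : Fin n) : ℝ := -R.b k (Pi.single k 1)

/-- `B_k(u) + β_k u_k`, a power series with nonnegative coefficients. -/
def N (k : Fin n) (u : Fin n → ℝ) : ℝ := genFun (R.bOff k) u

/-- The rates `a_j`, `j ≠ 0`, extended by zero to `j = 0`. -/
def aOff : (Fin n → ℕ) → ℝ := Function.update R.a 0 0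

lemma beta_pos (k : Fin n) : 0 < R.beta k := R.b_pos k

lemma bOff_nonneg (k : Fin n) (m : Fin n → ℕ) : 0 ≤ R.bOff k m := by
  by_cases h : m = Pi.single k 1
  · simp [bOff, h]
  · simpa [bOff, h] using R.b_nonneg k m h

lemma aOff_nonneg (m : Fin n → ℕ) : 0 ≤ R.aOff m := by
  by_cases h : m = 0
  · simp [aOff, h]
  · simpa [aOff, h] using R.a_nonneg m h

lemma hasSum_bOff (k : Fin n) : HasSum (R.bOff k) (R.beta k) := hasSum_update_zero (R.b_hasSum k)

lemma hasSum_aOff : HasSum R.aOff (-R.a 0) := hasSum_update_zero R.a_hasSum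

lemma hasSum_b (k : Fin n) : HasSum (R.b k) 0 := by
  simpa using hasSum_of_hasSum_ne (R.b_hasSum k)

lemma hasSum_a : HasSum R.a 0 := by
  simpa using hasSum_of_hasSum_ne R.a_hasSum

lemma B_eq (k : Fin n) {u : Fin n → ℝ} (hu : u ∈ Icc (0 : Fin n → ℝ) 1) :
    R.B k u = R.N k u - R.beta k * u k := by
  rw [B, genFun_eq_update_add (R.hasSum_b k).summable (Pi.single k 1) hu, monomial_single]
  simp [N, beta, bOff]

lemma A_eq {u : Fin n → ℝ} (hu : u ∈ Icc (0 : Fin n → ℝ) 1) :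
    R.A u = genFun R.aOff u + R.a 0 := by
  rw [A, genFun_eq_update_add R.hasSum_a.summable 0 hu, monomial_zero_left]
  simp [aOff]

lemma N_nonneg (k : Fin n) {u : Fin n → ℝ} (hu : 0 ≤ u) : 0 ≤ R.N k u :=
  genFun_nonneg (R.bOff_nonneg k) hu

lemma N_mono (k : Fin n) {u v : Fin n → ℝ} (hu : 0 ≤ u) (huv : u ≤ v) (hv : v ≤ 1) :
    R.N k u ≤ R.N k v :=
  genFun_mono (R.bOff_nonneg k) (R.hasSum_bOff k).summable hu huv hv

lemma N_one (k : Fin n) : R.N k 1 = R.beta k := by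
  rw [N, genFun_one, (R.hasSum_bOff k).tsum_eq]

lemma N_le_beta (k : Fin n) {u : Fin n → ℝ} (hu : u ∈ Icc (0 : Fin n → ℝ) 1) :
    R.N k u ≤ R.beta k :=
  (R.N_mono k hu.1 hu.2 le_rfl).trans_eq (R.N_one k)

lemma continuousOn_N (k : Fin n) : ContinuousOn (R.N k) (Icc 0 1) :=
  continuousOn_genFun (R.hasSum_bOff k).summable

lemma continuousOn_B (k : Fin n) : ContinuousOn (R.B k) (Icc 0 1) :=
  continuousOn_genFun (R.hasSum_b k).summable

lemma continuousOn_A : ContinuousOn R.A (Icc 0 1) :=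
  continuousOn_genFun R.hasSum_a.summable

lemma B_one (k : Fin n) : R.B k 1 = 0 := by
  rw [B, genFun_one, (R.hasSum_b k).tsum_eq]

lemma B_zero (k : Fin n) : R.B k 0 = R.b k 0 := genFun_zero _

lemma N_zero (k : Fin n) : R.N k 0 = R.B k 0 := by
  rw [R.B_eq k ⟨le_rfl, zero_le_one⟩]
  simp

lemma A_nonpos {u : Fin n → ℝ} (hu : u ∈ Icc (0 : Fin n → ℝ) 1) : R.A u ≤ 0 := by
  have h := genFun_mono R.aOff_nonneg R.hasSum_aOff.summable hu.1 hu.2 le_rfl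
  rw [genFun_one, R.hasSum_aOff.tsum_eq] at h
  rw [R.A_eq hu]
  linarith

lemma A_mono {u v : Fin n → ℝ} (hu : 0 ≤ u) (huv : u ≤ v) (hv : v ≤ 1) : R.A u ≤ R.A v := by
  rw [R.A_eq ⟨hu, huv.trans hv⟩, R.A_eq ⟨hu.trans huv, hv⟩]
  have := genFun_mono R.aOff_nonneg R.hasSum_aOff.summable hu huv hv
  linarith

lemma exists_a_pos : ∃ m : Fin n → ℕ, m ≠ 0 ∧ 0 < R.a m := by
  by_contra! h
  have h0 : (fun j : {j : Fin n → ℕ // j ≠ 0} => R.a j) = fun _ => 0 := by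
    funext j
    exact le_antisymm (h j j.2) (R.a_nonneg j j.2)
  have h1 := R.a_hasSum
  rw [h0] at h1
  exact R.a_pos.ne (hasSum_zero.unique h1)

/-- Some immigration rate `a m`, `m ≠ 0`, is positive, and its monomial is strictly below `1` at
`u`. -/
lemma A_neg {u : Fin n → ℝ} (hu : 0 ≤ u) (hu1 : ∀ k, u k < 1) : R.A u < 0 := by
  have hu' : u ∈ Icc (0 : Fin n → ℝ) 1 := ⟨hu, fun k => (hu1 k).le⟩
  obtain ⟨m, hm, hpos⟩ := R.exists_a_pos
  have h : genFun R.aOff u < ∑' m, R.aOff m := by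
    refine Summable.tsum_lt_tsum (i := m) ?_ ?_
      (summable_mul_monomial R.hasSum_aOff.summable hu') R.hasSum_aOff.summable
    · exact fun m => mul_le_of_le_one_right (R.aOff_nonneg m) (monomial_le_one m hu')
    · have : R.aOff m = R.a m := by simp [aOff, hm]
      rw [this]
      exact mul_lt_of_lt_one_right hpos (monomial_lt_one hm hu hu1)
  rw [R.hasSum_aOff.tsum_eq] at h
  rw [R.A_eq hu']
  linarith

/-! ### The rows of the `q`-matrix -/

lemma qMatrix_zero (j : Fin n → ℕ) : R.qMatrix 0 j = 0 := by simp [qMatrix]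

lemma qMatrix_self {i : Fin n → ℕ} (hi : i ≠ 0) :
    R.qMatrix i i = -(∑ k, (i k : ℝ) * R.beta k + -R.a 0) := by
  simp [qMatrix, hi, beta, Finset.sum_neg_distrib, add_comm]

lemma qMatrix_self_neg {i : Fin n → ℕ} (hi : i ≠ 0) : R.qMatrix i i < 0 := by
  rw [R.qMatrix_self hi, neg_lt_zero]
  have := Finset.sum_nonneg (s := Finset.univ)
    fun k _ => mul_nonneg (Nat.cast_nonneg (α := ℝ) (i k)) (R.beta_pos k).le
  linarith [R.a_pos]

lemma qMatrix_nonneg {i j : Fin n → ℕ} (hij : j ≠ i) : 0 ≤ R.qMatrix i j := by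
  unfold qMatrix
  split_ifs with hi h
  · rfl
  · refine add_nonneg (Finset.sum_nonneg fun k _ => mul_nonneg (Nat.cast_nonneg _) ?_)
      (R.a_nonneg _ fun h0 => hij (le_antisymm (tsub_eq_zero_iff_le.1 h0) h))
    split_ifs with hk
    · refine R.b_nonneg k _ fun h0 => hij ?_
      have := tsub_add_cancel_of_le hk
      rw [h0, add_comm (Pi.single k 1) i] at this
      exact (add_right_cancel this).symm
    · rfl
  · rw [add_zero]
    refine Finset.sum_nonneg fun k _ => mul_nonneg (Nat.cast_nonneg _) ?_
    split_ifs with hk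
    · refine R.b_nonneg k _ fun h0 => hij ?_
      have := tsub_add_cancel_of_le hk
      rw [h0, add_comm (Pi.single k 1) i] at this
      exact (add_right_cancel this).symm
    · rfl

/-- Immigration can always increase the state; the branching contributions to the same jump are
nonnegative. This makes the maximum principle work. -/
lemma a_le_qMatrix_add {i m : Fin n → ℕ} (hi : i ≠ 0) (hm : m ≠ 0) :
    R.a m ≤ R.qMatrix i (i + m) := by
  simp only [qMatrix, hi, if_false, le_add_iff_nonneg_right, zero_le, if_true,
    add_tsub_cancel_left]
  refine le_add_of_nonneg_left ?_
  refine Finset.sum_nonneg fun k _ => mul_nonneg (Nat.cast_nonneg (α := ℝ) (i k)) ?_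
  have h : i ≤ i + m + Pi.single k 1 := by rw [add_assoc]; exact le_self_add (a := i)
  rw [if_pos h, add_assoc, add_tsub_cancel_left]
  exact R.b_nonneg k _ fun h0 => hm (by simpa using h0)

lemma hasSum_shift {f : (Fin n → ℕ) → ℝ} (hf : Summable f) (d : Fin n → ℕ) {u : Fin n → ℝ}
    (hu : u ∈ Icc (0 : Fin n → ℝ) 1) :
    HasSum (fun j => (open Classical in if d ≤ j then f (j - d) else 0) * monomial j u)
      (monomial d u * genFun f u) := by
  have hinj : Function.Injective fun m : Fin n → ℕ => d + m := add_right_injective d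
  refine (hinj.hasSum_iff ?_).1 ?_
  · intro j hj
    rw [if_neg, zero_mul]
    exact fun h => hj ⟨j - d, add_tsub_cancel_of_le h⟩
  · have := (summable_mul_monomial hf hu).hasSum.mul_left (monomial d u)
    refine this.congr_fun fun m => ?_
    simp [monomial_add]
    ring

/-- The generating function of a row of the `q`-matrix. -/
lemma hasSum_qMatrix_mul_monomial {i : Fin n → ℕ} (hi : i ≠ 0) {u : Fin n → ℝ}
    (hu : u ∈ Icc (0 : Fin n → ℝ) 1) :
    HasSum (fun j => R.qMatrix i j * monomial j u)
      (∑ k, (i k : ℝ) * (monomial (i - Pi.single k 1) u * R.B k u) + monomial i u * R.A u) := by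
  classical
  have h1 := hasSum_sum (s := Finset.univ) fun (k : Fin n) _ =>
    (hasSum_shift (R.hasSum_b k).summable (i - Pi.single k 1) hu).mul_left (i k : ℝ)
  refine (h1.add (hasSum_shift R.hasSum_a.summable i hu)).congr_fun ?_
  intro j
  simp only [qMatrix, hi, if_false, add_mul, Finset.sum_mul]
  congr 1
  · refine Finset.sum_congr rfl fun k _ => ?_
    -- For `i k = 0` the truncated difference `i - e_k` is just `i`, but the coefficient `i k`
    -- removes the term.
    rcases Nat.eq_zero_or_pos (i k) with h0 | h0
    · simp [h0]
    · have hle : (Pi.single k 1 : Fin n → ℕ) ≤ i := by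
        intro l
        by_cases h : l = k
        · subst h; simpa [Nat.one_le_iff_ne_zero] using h0.ne'
        · simp [h]
      rw [mul_assoc, tsub_le_iff_right]
      have : j - (i - Pi.single k 1) = j + Pi.single k 1 - i := tsub_tsub_eq_add_tsub_of_le hle
      rw [this]

lemma hasSum_qMatrix {i : Fin n → ℕ} (hi : i ≠ 0) : HasSum (R.qMatrix i) 0 := by
  have h := R.hasSum_qMatrix_mul_monomial hi (u := 1) ⟨zero_le_one, le_rfl⟩
  have hA : R.A 1 = 0 := by rw [A, genFun_one, R.hasSum_a.tsum_eq]
  simpa [monomial_one_right, B_one, hA] using h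

/-! ### Finite means -/

variable {R}

/-- Summing `abs_monomial_sub_le` against the rates gives first absolute moments, which are finite
by assumption. -/
lemma FiniteMeans.lipschitz (hR : R.FiniteMeans) :
    ∃ L : ℝ, 0 ≤ L ∧ ∀ k, ∀ u ∈ Icc (0 : Fin n → ℝ) 1, ∀ v ∈ Icc (0 : Fin n → ℝ) 1,
      |R.B k u - R.B k v| ≤ L * ‖u - v‖ := by
  have hS : ∀ k l, 0 ≤ ∑' m : Fin n → ℕ, |R.b k m * (m l : ℝ)| :=
    fun k l => tsum_nonneg fun m => abs_nonneg _
  refine ⟨∑ k, ∑ l, ∑' m : Fin n → ℕ, |R.b k m * (m l : ℝ)|,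
    Finset.sum_nonneg fun k _ => Finset.sum_nonneg fun l _ => hS k l, ?_⟩
  intro k u hu v hv
  have hsum : Summable fun m : Fin n → ℕ => ∑ l, |R.b k m * (m l : ℝ)| * ‖u - v‖ :=
    summable_sum fun l _ => (hR k l).abs.mul_right _
  have h1 : R.B k u - R.B k v = ∑' m, R.b k m * (monomial m u - monomial m v) := by
    simp only [mul_sub]
    exact ((summable_mul_monomial (R.hasSum_b k).summable hu).tsum_sub
      (summable_mul_monomial (R.hasSum_b k).summable hv)).symm
  have h2 : |R.B k u - R.B k v| ≤ ∑' m : Fin n → ℕ, ∑ l, |R.b k m * (m l : ℝ)| * ‖u - v‖ := by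
    rw [h1]
    rw [← Real.norm_eq_abs]
    refine tsum_of_norm_bounded hsum.hasSum fun m => ?_
    rw [norm_mul, Real.norm_eq_abs, Real.norm_eq_abs]
    refine (mul_le_mul_of_nonneg_left (abs_monomial_sub_le m hu hv) (abs_nonneg _)).trans ?_
    rw [Finset.mul_sum]
    refine Finset.sum_le_sum fun l _ => ?_
    rw [abs_mul, Nat.abs_cast, ← mul_assoc]
    have hn : |u l - v l| ≤ ‖u - v‖ := norm_le_pi_norm (u - v) l
    exact mul_le_mul_of_nonneg_left hn (by positivity)
  refine h2.trans ?_
  rw [Summable.tsum_finsetSum fun l _ => (hR k l).abs.mul_right _]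
  simp only [tsum_mul_right]
  rw [← Finset.sum_mul]
  refine mul_le_mul_of_nonneg_right ?_ (norm_nonneg _)
  exact Finset.single_le_sum (f := fun k => ∑ l, ∑' m : Fin n → ℕ, |R.b k m * (m l : ℝ)|)
    (fun k _ => Finset.sum_nonneg fun l _ => hS k l) (Finset.mem_univ k)

lemma derivMatrix_one_apply (k l : Fin n) :
    R.derivMatrix 1 k l = ∑' m : Fin n → ℕ, R.b k m * (m l : ℝ) := by
  simp [derivMatrix, genFunDeriv, monomial_one_right]

/-- Writes the linearisation at `1` as a series over offspring vectors, so that it can be compared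
term by term with the series of `B_k`. -/
lemma FiniteMeans.hasSum_mulVec (hR : R.FiniteMeans) (k : Fin n) (x : Fin n → ℝ) :
    HasSum (fun m : Fin n → ℕ => R.b k m * ∑ l, (m l : ℝ) * x l)
      ((R.derivMatrix 1).mulVec x k) := by
  have h := hasSum_sum (s := Finset.univ) fun (l : Fin n) _ => (hR k l).hasSum.mul_right (x l)
  have hM : (R.derivMatrix 1).mulVec x k = ∑ l, (∑' m : Fin n → ℕ, R.b k m * (m l : ℝ)) * x l := by
    simp only [Matrix.mulVec, dotProduct, derivMatrix_one_apply]
  rw [hM]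
  refine h.congr_fun fun m => ?_
  rw [Finset.mul_sum]
  exact Finset.sum_congr rfl fun l _ => by ring

end Rates

/-! ### Positive eigenvectors of primitive matrices -/

section PerronFrobenius

variable {ι : Type*} [Fintype ι]

lemma mulVec_pos {P : Matrix ι ι ℝ} (hP : ∀ i j, 0 < P i j) {x : ι → ℝ} (hx : 0 ≤ x)
    (hx0 : x ≠ 0) (i : ι) : 0 < P.mulVec x i := by
  obtain ⟨j, hj⟩ := Function.ne_iff.1 hx0
  exact Finset.sum_pos' (fun k _ => mul_nonneg (hP i k).le (hx k))
    ⟨j, Finset.mem_univ j, mul_pos (hP i j) (lt_of_le_of_ne (hx j) (Ne.symm hj))⟩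

lemma mulVec_mono {A : Matrix ι ι ℝ} (hA : ∀ i j, 0 ≤ A i j) {x y : ι → ℝ} (hxy : x ≤ y) :
    A.mulVec x ≤ A.mulVec y :=
  fun i => Finset.sum_le_sum fun j _ => mul_le_mul_of_nonneg_left (hxy j) (hA i j)

variable [DecidableEq ι]

lemma pow_mulVec_of_mulVec_eq {A : Matrix ι ι ℝ} {x : ι → ℝ} {c : ℝ} (h : A.mulVec x = c • x)
    (m : ℕ) : (A ^ m).mulVec x = c ^ m • x := by
  induction m with
  | zero => simp
  | succ m ih => rw [pow_succ, ← Matrix.mulVec_mulVec, h, Matrix.mulVec_smul, ih, smul_smul,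
      mul_comm, ← pow_succ]

/-- A nonzero nonnegative eigenvector of a primitive matrix is positive. -/
lemma pos_of_mulVec_eq {A : Matrix ι ι ℝ} (hA : A.IsPrimitive) {x : ι → ℝ} (hx : 0 ≤ x)
    (hx0 : x ≠ 0) {c : ℝ} (h : A.mulVec x = c • x) (i : ι) : 0 < x i := by
  obtain ⟨m, -, hm⟩ := hA.exists_pos_pow
  have h1 := mulVec_pos hm hx hx0 i
  rw [pow_mulVec_of_mulVec_eq h] at h1
  refine lt_of_le_of_ne (hx i) fun h2 => ?_
  simp [← h2] at h1

/-- The Perron–Frobenius theorem: a primitive matrix has a positive eigenvector. -/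
theorem exists_pos_eigenvector [Nonempty ι] {A : Matrix ι ι ℝ} (hA : A.IsPrimitive) :
    ∃ (c : ℝ) (x : ι → ℝ), (∀ i, 0 < x i) ∧ A.mulVec x = c • x := by
  set C : ℝ := ∑ i, ∑ j, A i j
  have hC : 0 ≤ C := Finset.sum_nonneg fun i _ => Finset.sum_nonneg fun j _ => hA.nonneg i j
  -- Collatz–Wielandt: maximise `c` subject to `c x ≤ A x` with `x` in the simplex. The bound `C`,
  -- the sum of all entries, makes the set compact and cannot obstruct the improvement below, by
  -- `hle2`.
  set K : Set (ℝ × (ι → ℝ)) := (Icc 0 C ×ˢ stdSimplex ℝ ι) ∩ {p | p.1 • p.2 ≤ A.mulVec p.2}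
  have hcl : IsClosed {p : ℝ × (ι → ℝ) | p.1 • p.2 ≤ A.mulVec p.2} := by
    refine isClosed_le (by fun_prop) ?_
    exact Continuous.matrix_mulVec continuous_const continuous_snd
  have hK : IsCompact K := (isCompact_Icc.prod (isCompact_stdSimplex ℝ ι)).inter_right hcl
  have hKne : K.Nonempty := by
    obtain ⟨i⟩ := ‹Nonempty ι›
    refine ⟨(0, Pi.single i 1), ⟨⟨le_rfl, hC⟩, single_mem_stdSimplex ℝ i⟩, ?_⟩
    simp only [mem_ofPred_eq, zero_smul]
    intro k
    exact Finset.sum_nonneg fun j _ => mul_nonneg (hA.nonneg k j)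
      ((single_mem_stdSimplex ℝ i).1 j)
  obtain ⟨⟨c, x⟩, ⟨⟨hc, hx⟩, hcx⟩, hmax⟩ := hK.exists_isMaxOn hKne continuous_fst.continuousOn
  simp only at hc hx
  change c • x ≤ A.mulVec x at hcx
  have hx0 : x ≠ 0 := by
    rintro rfl
    simpa using hx.2
  have hxnn : 0 ≤ x := hx.1
  have heq : A.mulVec x = c • x := by
    by_contra hne
    obtain ⟨m, -, hm⟩ := hA.exists_pos_pow
    -- `A ^ m` commutes with `A - c`, so it turns a nonzero nonnegative defect into a strictly
    -- positive one, leaving room to raise `c` by `ε`.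
    set y := (A ^ m).mulVec x
    have hy : ∀ i, 0 < y i := mulVec_pos hm hxnn hx0
    have hd : ∀ i, 0 < (A.mulVec y - c • y) i := by
      have : A.mulVec y - c • y = (A ^ m).mulVec (A.mulVec x - c • x) := by
        rw [Matrix.mulVec_sub, Matrix.mulVec_smul, Matrix.mulVec_mulVec, Matrix.mulVec_mulVec,
          ← pow_succ, ← pow_succ']
      rw [this]
      exact mulVec_pos hm (sub_nonneg.2 hcx) (sub_ne_zero.2 hne)
    obtain ⟨i0, -, hi0⟩ := Finset.exists_min_image Finset.univ
      (fun i => (A.mulVec y - c • y) i / y i) Finset.univ_nonempty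
    set ε := (A.mulVec y - c • y) i0 / y i0
    have hε : 0 < ε := div_pos (hd i0) (hy i0)
    have hle : ∀ i, (c + ε) * y i ≤ A.mulVec y i := by
      intro i
      have := hi0 i (Finset.mem_univ i)
      rw [le_div_iff₀ (hy i)] at this
      simp only [Pi.sub_apply, Pi.smul_apply, smul_eq_mul] at this
      linarith
    set s := ∑ i, y i
    have hs : 0 < s := Finset.sum_pos (fun i _ => hy i) Finset.univ_nonempty
    have hle2 : (c + ε) * s ≤ C * s := by
      rw [Finset.mul_sum]
      refine (Finset.sum_le_sum fun i _ => hle i).trans ?_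
      simp only [C, Finset.sum_mul]
      refine Finset.sum_le_sum fun i _ => Finset.sum_le_sum fun j _ => ?_
      exact mul_le_mul_of_nonneg_left
        (Finset.single_le_sum (fun i _ => (hy i).le) (Finset.mem_univ j)) (hA.nonneg i j)
    have hmem : (c + ε, s⁻¹ • y) ∈ K := by
      refine ⟨⟨⟨by linarith [hc.1], le_of_mul_le_mul_right hle2 hs⟩, ?_, ?_⟩, ?_⟩
      · exact fun i => mul_nonneg (inv_nonneg.2 hs.le) (hy i).le
      · simp only [Pi.smul_apply, smul_eq_mul, ← Finset.mul_sum]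
        exact inv_mul_cancel₀ hs.ne'
      · change (c + ε) • s⁻¹ • y ≤ A.mulVec (s⁻¹ • y)
        rw [smul_comm, Matrix.mulVec_smul]
        exact smul_le_smul_of_nonneg_left (fun i => hle i) (inv_nonneg.2 hs.le)
    have := hmax hmem
    simp only [mem_ofPred_eq] at this
    linarith
  exact ⟨c, x, pos_of_mulVec_eq hA hxnn hx0 heq, heq⟩

lemma isPrimitive_transpose {A : Matrix ι ι ℝ} (hA : A.IsPrimitive) : A.transpose.IsPrimitive := by
  obtain ⟨m, hm0, hm⟩ := hA.exists_pos_pow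
  refine ⟨fun i j => hA.nonneg j i, m, hm0, fun i j => ?_⟩
  rw [← Matrix.transpose_pow]
  exact hm j i

lemma pow_apply_le_pow_apply {A B : Matrix ι ι ℝ} (hA : ∀ i j, 0 ≤ A i j)
    (hAB : ∀ i j, A i j ≤ B i j) (m : ℕ) :
    ∀ i j, 0 ≤ (A ^ m) i j ∧ (A ^ m) i j ≤ (B ^ m) i j := by
  induction m with
  | zero =>
    intro i j
    simp only [pow_zero, le_refl, and_true, Matrix.one_apply]
    split_ifs <;> norm_num
  | succ m ih =>
    intro i j
    simp only [pow_succ, Matrix.mul_apply]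
    exact ⟨Finset.sum_nonneg fun k _ => mul_nonneg (ih i k).1 (hA k j),
      Finset.sum_le_sum fun k _ => mul_le_mul (ih i k).2 (hAB k j) (hA k j)
        ((ih i k).1.trans (ih i k).2)⟩

/-- Powers of nonnegative matrices are monotone entrywise, so the positive power of `A` forces the
same power of `B` to be positive. -/
lemma isPrimitive_of_smul_le {A B : Matrix ι ι ℝ} (hA : A.IsPrimitive) {δ : ℝ} (hδ : 0 < δ)
    (hAB : ∀ i j, δ * A i j ≤ B i j) : B.IsPrimitive := by
  have h0 : ∀ i j, 0 ≤ (δ • A) i j := fun i j => mul_nonneg hδ.le (hA.nonneg i j)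
  obtain ⟨m, hm0, hm⟩ := hA.exists_pos_pow
  refine ⟨fun i j => (h0 i j).trans (hAB i j), m, hm0, fun i j => ?_⟩
  refine lt_of_lt_of_le ?_ (pow_apply_le_pow_apply h0 hAB m i j).2
  rw [smul_pow]
  exact mul_pos (pow_pos hδ m) (hm i j)

lemma mem_spectrum_iff_det_eq_zero {A : Matrix ι ι ℝ} {c : ℝ} :
    c ∈ spectrum ℝ A ↔ (algebraMap ℝ (Matrix ι ι ℝ) c - A).det = 0 := by
  rw [spectrum.mem_iff, Matrix.isUnit_iff_isUnit_det, isUnit_iff_ne_zero, not_not]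

end PerronFrobenius

/-! ### Perron vectors of the derivative matrix at `1` -/

namespace Rates

variable {n : ℕ} {R : Rates n}

/-- A uniform bound for the branching rates. -/
def betaSum (R : Rates n) : ℝ := ∑ k, R.beta k

/-- A shift of the matrix of partial derivatives at `1` by a multiple of the identity is
primitive. -/
lemma isPrimitive_derivMatrix_add [NeZero n] (hA3 : (R.meanMatrix 1).IsPrimitive) :
    (R.derivMatrix 1 + R.betaSum • (1 : Matrix (Fin n) (Fin n) ℝ)).IsPrimitive := by
  -- Row `i` of the mean matrix, multiplied by `β_i`, is the row of derivatives plus `β_i` on the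
  -- diagonal. The smallest `β` serves all rows as the comparison factor.
  obtain ⟨k0, -, hk0⟩ := Finset.exists_min_image Finset.univ R.beta Finset.univ_nonempty
  refine isPrimitive_of_smul_le hA3 (R.beta_pos k0) fun i j => ?_
  have h1 : R.beta k0 * R.meanMatrix 1 i j ≤ R.beta i * R.meanMatrix 1 i j :=
    mul_le_mul_of_nonneg_right (hk0 i (Finset.mem_univ i)) (hA3.nonneg i j)
  refine h1.trans ?_
  have hb : R.b i (Pi.single i 1) = -R.beta i := by simp [beta]
  have h2 : R.beta i * R.meanMatrix 1 i j
      = (if i = j then R.beta i else 0) + R.derivMatrix 1 i j := by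
    have := (R.beta_pos i).ne'
    simp only [meanMatrix, Matrix.of_apply, hb]
    split_ifs <;> field_simp <;> ring
  rw [h2, Matrix.add_apply, Matrix.smul_apply, Matrix.one_apply, add_comm]
  have hle : R.beta i ≤ R.betaSum :=
    Finset.single_le_sum (fun k _ => (R.beta_pos k).le) (Finset.mem_univ i)
  split_ifs <;> simp [hle]

lemma betaSum_pos [NeZero n] (R : Rates n) : 0 < R.betaSum :=
  Finset.sum_pos (fun k _ => R.beta_pos k) Finset.univ_nonempty

/-- The matrix of partial derivatives at `1` has a positive left eigenvector, with an eigenvalue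
which is at most `ρ(1)`. -/
lemma exists_left_eigenvector [NeZero n] (hA3 : (R.meanMatrix 1).IsPrimitive) :
    ∃ (c : ℝ) (w : Fin n → ℝ), (∀ k, 0 < w k) ∧ c ≤ R.rho 1 ∧
      ∀ x, w ⬝ᵥ (R.derivMatrix 1).mulVec x = c * (w ⬝ᵥ x) := by
  obtain ⟨c, w, hw, h⟩ := exists_pos_eigenvector
    (isPrimitive_transpose (isPrimitive_derivMatrix_add hA3))
  set M := R.derivMatrix 1
  have hM : M.transpose.mulVec w = (c - R.betaSum) • w := by
    rw [Matrix.transpose_add, Matrix.add_mulVec, Matrix.transpose_smul, Matrix.transpose_one,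
      Matrix.smul_mulVec, Matrix.one_mulVec] at h
    rw [sub_smul, ← h]
    simp
  refine ⟨c - R.betaSum, w, hw, ?_, fun x => ?_⟩
  · refine le_csSup (Matrix.finite_real_spectrum).bddAbove ?_
    rw [mem_spectrum_iff_det_eq_zero, ← Matrix.exists_vecMul_eq_zero_iff]
    refine ⟨w, fun h0 => (hw 0).ne' (congrFun h0 0), ?_⟩
    rw [Matrix.vecMul_sub, ← Matrix.mulVec_transpose M, hM, Algebra.algebraMap_eq_smul_one,
      Matrix.vecMul_smul, Matrix.vecMul_one, sub_self]
  · rw [Matrix.dotProduct_mulVec, ← Matrix.mulVec_transpose, hM, smul_dotProduct, smul_eq_mul]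

/-- If `ρ(1) > 0` there is a positive vector on which the matrix of partial derivatives at `1`
acts expansively. -/
lemma exists_pos_mulVec_pos [NeZero n] (hA3 : (R.meanMatrix 1).IsPrimitive) (hrho : 0 < R.rho 1) :
    ∃ h : Fin n → ℝ, (∀ k, 0 < h k) ∧ ∀ k, 0 < (R.derivMatrix 1).mulVec h k := by
  obtain ⟨c, hc, hc0⟩ : ∃ c ∈ spectrum ℝ (R.derivMatrix 1), 0 < c := by
    by_contra! h
    exact hrho.not_ge (Real.sSup_nonpos h)
  rw [mem_spectrum_iff_det_eq_zero, ← Matrix.exists_mulVec_eq_zero_iff] at hc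
  obtain ⟨z, hz, hMz⟩ := hc
  set M := R.derivMatrix 1
  set s := R.betaSum
  have hs : 0 < s := R.betaSum_pos
  have hprim := isPrimitive_derivMatrix_add hA3
  set P := M + s • (1 : Matrix (Fin n) (Fin n) ℝ)
  have hP : ∀ x, P.mulVec x = M.mulVec x + s • x := fun x => by
    rw [Matrix.add_mulVec, Matrix.smul_mulVec, Matrix.one_mulVec]
  have hPz : P.mulVec z = (c + s) • z := by
    rw [Matrix.sub_mulVec, Algebra.algebraMap_eq_smul_one, Matrix.smul_mulVec, Matrix.one_mulVec,
      sub_eq_zero] at hMz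
    rw [hP, ← hMz, add_smul]
  -- By the triangle inequality, `|z|` is subinvariant for the nonnegative matrix `P`. A positive
  -- power of `P` then makes it a strictly positive vector that is still subinvariant, which is the
  -- required `h`.
  have habs : (c + s) • |z| ≤ P.mulVec |z| := by
    intro k
    have h1 : (c + s) * |z k| = |P.mulVec z k| := by
      rw [hPz, Pi.smul_apply, smul_eq_mul, abs_mul, abs_of_pos (by linarith : 0 < c + s)]
    change (c + s) * |z k| ≤ _
    rw [h1]
    have h2 : P.mulVec |z| k = ∑ l, |P k l * z l| := by
      simp only [Matrix.mulVec, dotProduct]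
      refine Finset.sum_congr rfl fun l _ => ?_
      rw [abs_mul, abs_of_nonneg (hprim.nonneg k l)]
      rfl
    rw [h2]
    simp only [Matrix.mulVec, dotProduct]
    exact Finset.abs_sum_le_sum_abs _ _
  obtain ⟨m, -, hm⟩ := hprim.exists_pos_pow
  have hz' : |z| ≠ 0 := by simpa using hz
  have hpos := mulVec_pos hm (abs_nonneg z) hz'
  refine ⟨(P ^ m).mulVec |z|, hpos, fun k => ?_⟩
  have h2 := mulVec_mono (fun i j => (hm i j).le) habs k
  rw [Matrix.mulVec_smul, Matrix.mulVec_mulVec, ← pow_succ, pow_succ', ← Matrix.mulVec_mulVec,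
    hP] at h2
  simp only [Pi.smul_apply, Pi.add_apply, smul_eq_mul] at h2
  nlinarith [mul_pos hc0 (hpos k)]

/-! ### The smallest zero and the sign of `ρ(1)` -/

/-- If `ρ(1) ≤ 0`, the only zero in the unit cube is `1`. -/
theorem eq_one_of_rho_nonpos [NeZero n] (hA2 : R.FiniteMeans) (hA3 : (R.meanMatrix 1).IsPrimitive)
    (hB : 0 < R.B 0 0) (hrho : R.rho 1 ≤ 0) {q : Fin n → ℝ} (hq : q ∈ R.zeros) : q = 1 := by
  obtain ⟨hq, hBq⟩ := hq
  obtain ⟨c, w, hw, hc, hwM⟩ := exists_left_eigenvector hA3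
  have hc0 : c ≤ 0 := hc.trans hrho
  set M := R.derivMatrix 1
  set x : Fin n → ℝ := 1 - q
  have hx : x ∈ Icc (0 : Fin n → ℝ) 1 := ⟨sub_nonneg.2 hq.2, by simpa [x] using hq.1⟩
  have hq' : q = 1 - x := by simp [x]
  by_contra hne
  have hx0 : x ≠ 0 := fun h => hne (by rw [hq', h, sub_zero])
  -- The terms of the first-order remainder of `B_k` at `1`. They sum to `M x` because `B_k`
  -- vanishes at both `q` and `1`.
  set D : Fin n → (Fin n → ℕ) → ℝ :=
    fun k m => R.b k m * (monomial m q - 1 + ∑ l, (m l : ℝ) * x l)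
  have hDsum : ∀ k, HasSum (D k) (M.mulVec x k) := by
    intro k
    have h1 := (summable_mul_monomial (R.hasSum_b k).summable hq).hasSum
    have h2 := (h1.sub (R.hasSum_b k)).add (hA2.hasSum_mulVec k x)
    have h3 : ∑' m, R.b k m * monomial m q = 0 := hBq k
    rw [h3, sub_zero, zero_add] at h2
    exact h2.congr_fun fun m => by simp only [D]; ring
  have hD0 : ∀ k m, 0 ≤ D k m := by
    intro k m
    -- The only possibly negative coefficient belongs to `e_k`, where the remainder of the linear
    -- monomial is zero.
    by_cases hm : m = Pi.single k 1
    · have h1 : ∑ l, ((Pi.single k 1 : Fin n → ℕ) l : ℝ) * x l = x k := by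
        rw [Finset.sum_eq_single k] <;> simp +contextual
      simp only [D, hm, monomial_single, h1, x]
      simp
    · refine mul_nonneg (R.b_nonneg k m hm) ?_
      have := one_sub_sum_le_monomial m hx
      rw [← hq'] at this
      linarith
  have hMx : ∀ k, 0 ≤ M.mulVec x k := fun k => (hDsum k).nonneg (hD0 k)
  have hwx : 0 ≤ w ⬝ᵥ x := Finset.sum_nonneg fun k _ => mul_nonneg (hw k).le (hx.1 k)
  have hwMx : w ⬝ᵥ M.mulVec x ≤ 0 := by
    rw [hwM]
    exact mul_nonpos_of_nonpos_of_nonneg hc0 hwx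
  have hMx0 : ∀ k, M.mulVec x k = 0 := by
    have h0 : ∀ k ∈ Finset.univ, 0 ≤ w k * M.mulVec x k :=
      fun k _ => mul_nonneg (hw k).le (hMx k)
    have h1 := (Finset.sum_eq_zero_iff_of_nonneg h0).1 (le_antisymm hwMx (Finset.sum_nonneg h0))
    exact fun k => (mul_eq_zero.1 (h1 k (Finset.mem_univ k))).resolve_left (hw k).ne'
  -- Since `M x = 0`, `x` is a nonnegative eigenvector of the primitive shifted matrix.
  have hxpos : ∀ k, 0 < x k := by
    refine pos_of_mulVec_eq (isPrimitive_derivMatrix_add hA3) hx.1 hx0 (c := R.betaSum) ?_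
    rw [Matrix.add_mulVec, Matrix.smul_mulVec, Matrix.one_mulVec, (funext hMx0 : M.mulVec x = 0),
      zero_add]
  -- All remainder terms vanish, while Bernoulli is strict in degree at least two; so the `B_k` are
  -- affine.
  have hb : ∀ k m, 2 ≤ ∑ l, m l → R.b k m = 0 := by
    intro k m hm
    have h1 := hDsum k
    rw [hMx0 k] at h1
    have h2 := congrFun ((hasSum_zero_iff_of_nonneg (hD0 k)).1 h1) m
    refine (mul_eq_zero.1 h2).resolve_right (ne_of_gt ?_)
    have := one_sub_sum_lt_monomial hx hxpos hm
    rw [← hq'] at this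
    linarith
  -- In degrees zero and one the factor `|m| - 1` is nonzero only at `m = 0`. As the Perron
  -- eigenvalue `c` turns out to be zero, pairing with `w` then contradicts `B_1(0) > 0`.
  have hM1 : ∀ k, M.mulVec 1 k = -R.B k 0 := by
    intro k
    have h1 := (hA2.hasSum_mulVec k 1).sub (R.hasSum_b k)
    rw [sub_zero] at h1
    refine h1.unique ?_
    rw [B_zero]
    refine (hasSum_ite_eq 0 (-R.b k 0)).congr_fun fun m => ?_
    split_ifs with h0
    · simp [h0]
    · rcases lt_or_ge (∑ l, m l) 2 with h2 | h2
      · have h3 : ∑ l, m l ≠ 0 := fun h => h0 (funext fun l => by simpa using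
          (Finset.sum_eq_zero_iff.1 h l (Finset.mem_univ l)))
        have h4 : ∑ l, m l = 1 := by omega
        have h5 : ∑ l, (m l : ℝ) = 1 := by exact_mod_cast h4
        simp [h5]
      · simp [hb k m h2]
  have hw1 : 0 < w ⬝ᵥ (1 : Fin n → ℝ) :=
    Finset.sum_pos (fun k _ => by simpa using hw k) Finset.univ_nonempty
  have hB0 : ∀ k, 0 ≤ R.B k 0 := fun k => by
    rw [← N_zero]
    exact R.N_nonneg k le_rfl
  have hneg : w ⬝ᵥ M.mulVec 1 < 0 := by
    have : w ⬝ᵥ M.mulVec 1 = -∑ k, w k * R.B k 0 := by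
      simp [dotProduct, hM1]
    rw [this, neg_lt_zero]
    exact Finset.sum_pos' (fun k _ => mul_nonneg (hw k).le (hB0 k))
      ⟨0, Finset.mem_univ 0, mul_pos (hw 0) hB⟩
  have hwx0 : 0 < w ⬝ᵥ x :=
    Finset.sum_pos (fun k _ => mul_pos (hw k) (hxpos k)) Finset.univ_nonempty
  have hc1 : c * (w ⬝ᵥ x) = 0 := by
    rw [← hwM, (funext hMx0 : M.mulVec x = 0), dotProduct_zero]
  have hc2 : c = 0 := (mul_eq_zero.1 hc1).resolve_right hwx0.ne'
  rw [hwM, hc2, zero_mul] at hneg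
  exact lt_irrefl _ hneg

/-- If `ρ(1) > 0` there is a point of the open cube at which all the `B_k` are negative. -/
lemma exists_B_neg [NeZero n] (hA2 : R.FiniteMeans) (hA3 : (R.meanMatrix 1).IsPrimitive)
    (hrho : 0 < R.rho 1) :
    ∃ z : Fin n → ℝ, z ∈ Icc (0 : Fin n → ℝ) 1 ∧ (∀ k, z k < 1) ∧ ∀ k, R.B k z ≤ 0 := by
  obtain ⟨h, hpos, hMh⟩ := exists_pos_mulVec_pos hA3 hrho
  set M := R.derivMatrix 1
  set z : ℝ → Fin n → ℝ := fun ε => 1 - ε • h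
  have hz : ∀ᶠ ε in 𝓝[>] (0 : ℝ), z ε ∈ Icc (0 : Fin n → ℝ) 1 ∧ ∀ k, z ε k < 1 := by
    have h1 : ∀ᶠ ε in 𝓝[>] (0 : ℝ), ∀ k, ε * h k < 1 := by
      refine eventually_all.2 fun k => ?_
      have : Tendsto (fun ε : ℝ => ε * h k) (𝓝[>] 0) (𝓝 0) := by
        have : Continuous fun ε : ℝ => ε * h k := by fun_prop
        simpa using (this.tendsto 0).mono_left nhdsWithin_le_nhds
      exact this.eventually_lt_const one_pos
    filter_upwards [h1, self_mem_nhdsWithin] with ε h1 h2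
    have h3 : ∀ k, 0 < ε * h k := fun k => mul_pos h2 (hpos k)
    refine ⟨⟨fun k => ?_, fun k => ?_⟩, fun k => ?_⟩ <;>
      simp only [z, Pi.sub_apply, Pi.smul_apply, smul_eq_mul, Pi.zero_apply, Pi.one_apply] <;>
      linarith [h1 k, h3 k]
  -- The directional derivative of `B_k` at `1` along `-h`, taken under the sum;
  -- `abs_monomial_sub_le` and finite means provide the dominating series.
  have hlim : ∀ k, Tendsto (fun ε => R.B k (z ε) / ε) (𝓝[>] 0) (𝓝 (-M.mulVec h k)) := by
    intro k
    have h1 : -M.mulVec h k = ∑' m : Fin n → ℕ, R.b k m * -∑ l, (m l : ℝ) * h l := by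
      rw [← (hA2.hasSum_mulVec k h).tsum_eq, ← tsum_neg]
      simp
    have h2 : ∀ᶠ ε in 𝓝[>] (0 : ℝ), ∑' m : Fin n → ℕ, R.b k m * ((monomial m (z ε) - 1) / ε)
        = R.B k (z ε) / ε := by
      filter_upwards [hz] with ε hε
      have h3 := ((summable_mul_monomial (R.hasSum_b k).summable hε.1).hasSum.sub
        (R.hasSum_b k)).div_const ε
      rw [sub_zero] at h3
      rw [B, genFun, ← h3.tsum_eq]
      exact tsum_congr fun m => by ring
    rw [h1]
    refine Tendsto.congr' h2 ?_
    refine tendsto_tsum_of_dominated_convergence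
      (bound := fun m : Fin n → ℕ => |R.b k m * ∑ l, (m l : ℝ) * h l|)
      (hA2.hasSum_mulVec k h).summable.abs (fun m => ?_) ?_
    · refine Tendsto.const_mul _ ?_
      have hd : ∀ l, HasDerivAt (fun ε : ℝ => z ε l ^ m l) (-((m l : ℝ) * h l)) 0 := by
        intro l
        have : HasDerivAt (fun ε : ℝ => z ε l) (-h l) 0 := by
          have := ((hasDerivAt_id (0 : ℝ)).mul_const (h l)).const_sub 1
          simpa [z] using this
        have := this.fun_pow (m l)
        simpa [z] using this
      have hd2 : HasDerivAt (fun ε => monomial m (z ε)) (-∑ l, (m l : ℝ) * h l) 0 := by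
        have := HasDerivAt.fun_finsetProd (u := Finset.univ) fun l _ => hd l
        simpa [z, monomial, Finset.sum_neg_distrib] using this
      have hd3 := hd2.tendsto_slope_zero_right
      refine hd3.congr fun ε => ?_
      simp [z, monomial_one_right, div_eq_inv_mul]
    · filter_upwards [hz, self_mem_nhdsWithin] with ε hε h2 m
      have hε0 : 0 < ε := h2
      rw [norm_mul, abs_mul, Real.norm_eq_abs]
      refine mul_le_mul_of_nonneg_left ?_ (abs_nonneg _)
      rw [norm_div, Real.norm_eq_abs, Real.norm_of_nonneg hε0.le, div_le_iff₀ hε0]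
      have h4 := abs_monomial_sub_le m hε.1 (v := 1) ⟨zero_le_one, le_rfl⟩
      rw [monomial_one_right] at h4
      refine h4.trans ?_
      rw [abs_of_nonneg (Finset.sum_nonneg fun l _ =>
        mul_nonneg (Nat.cast_nonneg _) (hpos l).le), Finset.sum_mul]
      refine Finset.sum_le_sum fun l _ => le_of_eq ?_
      have h5 : |z ε l - (1 : Fin n → ℝ) l| = ε * h l := by
        simp [z, abs_of_pos hε0, abs_of_pos (hpos l)]
      rw [h5]
      ring
  have hfin : ∀ᶠ ε in 𝓝[>] (0 : ℝ), ∀ k, R.B k (z ε) / ε < 0 :=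
    eventually_all.2 fun k => (hlim k).eventually_lt_const (neg_lt_zero.2 (hMh k))
  obtain ⟨ε, hε, hε2, hε3⟩ := (hz.and (hfin.and self_mem_nhdsWithin)).exists
  refine ⟨z ε, hε.1, hε.2, fun k => ?_⟩
  by_contra! hk
  exact (hε2 k).not_ge (div_nonneg hk.le (le_of_lt hε3))

end Rates

namespace Rates

variable {n : ℕ} {R : Rates n}

/-! ### The flow of the vector field `(B_1, …, B_n)` started at the origin -/

/-- `V` is the solution `V' = (B_1(V), …, B_n(V))`, `V(0) = 0`, in integrated form, extended by
zero to negative times, and bounded by every point of the cube at which all `B_k` are nonpositive.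
-/
structure IsFlow (R : Rates n) (V : ℝ → Fin n → ℝ) : Prop where
  mono : Monotone V
  mem : ∀ t, V t ∈ Icc (0 : Fin n → ℝ) 1
  eq_zero : ∀ t ≤ 0, V t = 0
  le_of_B_nonpos : ∀ z ∈ Icc (0 : Fin n → ℝ) 1, (∀ k, R.B k z ≤ 0) → ∀ t, V t ≤ z
  integral_eq : ∀ t, 0 ≤ t → ∀ k,
    V t k = ∫ s in (0 : ℝ)..t, Real.exp (-R.beta k * (t - s)) * R.N k (V s)

lemma integral_beta_mul_exp (β : ℝ) (T : ℝ) :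
    ∫ s in (0 : ℝ)..T, β * Real.exp (-β * s) = 1 - Real.exp (-β * T) := by
  have h : ∀ s ∈ uIcc 0 T, HasDerivAt (fun s => -Real.exp (-β * s)) (β * Real.exp (-β * s)) s := by
    intro s _
    have := (((hasDerivAt_id s).const_mul (-β)).exp).neg
    refine this.congr_deriv ?_
    simp only [id_eq, mul_one]
    ring
  rw [intervalIntegral.integral_eq_sub_of_hasDerivAt h
    (Continuous.intervalIntegrable (by fun_prop) _ _)]
  simp
  ring

lemma monotone_N_comp (k : Fin n) {V : ℝ → Fin n → ℝ} (hV : Monotone V)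
    (hmem : ∀ t, V t ∈ Icc (0 : Fin n → ℝ) 1) : Monotone fun t => R.N k (V t) :=
  fun s t hst => R.N_mono k (hmem s).1 (hV hst) (hmem t).2

lemma antitone_exp_neg_mul {β : ℝ} (hβ : 0 ≤ β) : Antitone fun s : ℝ => Real.exp (-β * s) :=
  fun s t hst => Real.exp_le_exp.2 (by nlinarith)

/-- Monotonicity suffices for integrability; functions in the Picard lattice need not be continuous.
-/
lemma intervalIntegrable_exp_mul_N (k : Fin n) {V : ℝ → Fin n → ℝ} (hV : Monotone V)
    (hmem : ∀ t, V t ∈ Icc (0 : Fin n → ℝ) 1) (t a b : ℝ) :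
    IntervalIntegrable (fun s => Real.exp (-R.beta k * s) * R.N k (V (t - s))) volume a b := by
  have h : Antitone fun s => R.N k (V (t - s)) :=
    fun s s' hs => monotone_N_comp k hV hmem (sub_le_sub_left hs t)
  refine Antitone.intervalIntegrable fun s s' hs => ?_
  exact mul_le_mul (antitone_exp_neg_mul (R.beta_pos k).le hs) (h hs)
    (R.N_nonneg k (hmem _).1) (Real.exp_pos _).le

/-- One step of the Picard iteration for the flow. -/
def picard (R : Rates n) (V : ℝ → Fin n → ℝ) (t : ℝ) (k : Fin n) : ℝ :=
  ∫ s in (0 : ℝ)..max t 0, Real.exp (-R.beta k * s) * R.N k (V (t - s))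

lemma picard_nonneg {V : ℝ → Fin n → ℝ} (hmem : ∀ t, V t ∈ Icc (0 : Fin n → ℝ) 1) (t : ℝ)
    (k : Fin n) : 0 ≤ R.picard V t k :=
  intervalIntegral.integral_nonneg (le_max_right t 0)
    fun _ _ => mul_nonneg (Real.exp_pos _).le (R.N_nonneg k (hmem _).1)

/-- Used twice: with `C = 1` it keeps the iteration in the cube, and with `C = z k` it turns a point
where `B ≤ 0` into a barrier. -/
lemma picard_le {V : ℝ → Fin n → ℝ} (hV : Monotone V)
    (hmem : ∀ t, V t ∈ Icc (0 : Fin n → ℝ) 1) {C : ℝ} {k : Fin n}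
    {t : ℝ} (hC : ∀ s ≤ t, R.N k (V s) ≤ R.beta k * C) :
    R.picard V t k ≤ C * (1 - Real.exp (-R.beta k * max t 0)) := by
  rw [← integral_beta_mul_exp, ← intervalIntegral.integral_const_mul]
  refine intervalIntegral.integral_mono_on (le_max_right t 0)
    (intervalIntegrable_exp_mul_N k hV hmem t _ _)
    (Continuous.intervalIntegrable (by fun_prop) _ _) fun s hs => ?_
  have := mul_le_mul_of_nonneg_left (hC (t - s) (by linarith [hs.1]))
    (Real.exp_pos (-R.beta k * s)).le
  linarith

lemma one_sub_exp_mem {β t : ℝ} (hβ : 0 < β) : 1 - Real.exp (-β * max t 0) ∈ Icc (0 : ℝ) 1 := by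
  have h1 : Real.exp (-β * max t 0) ≤ 1 :=
    Real.exp_le_one_iff.2 (by nlinarith [le_max_right t 0])
  have h2 := Real.exp_pos (-β * max t 0)
  constructor <;> linarith

lemma picard_le_one {V : ℝ → Fin n → ℝ} (hV : Monotone V)
    (hmem : ∀ t, V t ∈ Icc (0 : Fin n → ℝ) 1) (t : ℝ) (k : Fin n) : R.picard V t k ≤ 1 := by
  have h := picard_le (R := R) (C := 1) (k := k) (t := t) hV hmem
    fun s _ => by simpa using R.N_le_beta k (hmem s)
  rw [one_mul] at h
  exact h.trans (one_sub_exp_mem (R.beta_pos k)).2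

lemma picard_mono {V W : ℝ → Fin n → ℝ} (hV : Monotone V) (hW : Monotone W)
    (hVm : ∀ t, V t ∈ Icc (0 : Fin n → ℝ) 1) (hWm : ∀ t, W t ∈ Icc (0 : Fin n → ℝ) 1)
    (hVW : ∀ t, V t ≤ W t) {s t : ℝ} (hst : s ≤ t) (k : Fin n) :
    R.picard V s k ≤ R.picard W t k := by
  refine (intervalIntegral.integral_mono_on (le_max_right s 0)
    (intervalIntegrable_exp_mul_N k hV hVm s _ _)
    (intervalIntegrable_exp_mul_N (R := R) k hW hWm t _ _) fun r _ => ?_).trans ?_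
  · exact mul_le_mul_of_nonneg_left (R.N_mono k (hVm _).1
      ((hV (sub_le_sub_right hst r)).trans (hVW _)) (hWm _).2) (Real.exp_pos _).le
  · refine intervalIntegral.integral_mono_interval le_rfl (le_max_right s 0)
      (max_le_max_right 0 hst) ?_ (intervalIntegrable_exp_mul_N k hW hWm t _ _)
    exact Eventually.of_forall fun r => mul_nonneg (Real.exp_pos _).le (R.N_nonneg k (hWm _).1)

/-- Knaster–Tarski. -/
lemma exists_least_fixedPoint {α : Type*} [CompleteLattice α] {f : α → α} (hf : Monotone f) :
    ∃ x, f x = x ∧ ∀ z, f z ≤ z → x ≤ z :=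
  ⟨OrderHom.lfp ⟨f, hf⟩, OrderHom.map_lfp ⟨f, hf⟩, fun _ hz => OrderHom.lfp_le ⟨f, hf⟩ hz⟩

/-- In the variation-of-constants form `V' + βV = N(V)` the Picard operator is order preserving,
because `N` has nonnegative coefficients. It acts on the complete lattice of monotone cube-valued
functions, and its least fixed point is the flow; leastness also supplies the barrier property. -/
theorem exists_isFlow (R : Rates n) : ∃ V, R.IsFlow V := by
  have : Fact ((0 : ℝ) ≤ 1) := ⟨zero_le_one⟩
  set F := ℝ →o (Fin n → Icc (0 : ℝ) 1)
  let c : F → ℝ → Fin n → ℝ := fun V t k => V t k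
  have hmono : ∀ V : F, Monotone (c V) := fun V s t hst k => V.monotone hst k
  have hmem : ∀ (V : F) t, c V t ∈ Icc (0 : Fin n → ℝ) 1 :=
    fun V t => ⟨fun k => (V t k).2.1, fun k => (V t k).2.2⟩
  let Φ : F → F := fun V =>
    { toFun := fun t k => ⟨R.picard (c V) t k, picard_nonneg (hmem V) t k,
        picard_le_one (hmono V) (hmem V) t k⟩
      monotone' := fun s t hst k => picard_mono (hmono V) (hmono V) (hmem V) (hmem V)
        (fun _ => le_rfl) hst k }
  have hΦ : Monotone Φ := fun V W hVW t k =>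
    picard_mono (hmono V) (hmono W) (hmem V) (hmem W) (fun t k => hVW t k) le_rfl k
  obtain ⟨V, h, hleast⟩ := exists_least_fixedPoint (α := F) hΦ
  have hfix : ∀ t k, c V t k = R.picard (c V) t k := fun t k =>
    congrArg (fun W : F => ((W t k : Icc (0 : ℝ) 1) : ℝ)) h.symm
  refine ⟨c V, hmono V, hmem V, ?_, ?_, ?_⟩
  · intro t ht
    funext k
    rw [hfix, picard, max_eq_right ht, intervalIntegral.integral_same]
    rfl
  · intro z hz hBz t
    -- `B_k(z) ≤ 0` means `N_k(z) ≤ β_k z_k`, so the constant `z` is a pre-fixed point.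
    let Z : F := ⟨fun _ k => ⟨z k, hz.1 k, hz.2 k⟩, fun _ _ _ => le_rfl⟩
    have hZ : Φ Z ≤ Z := by
      intro t k
      have h := picard_le (R := R) (C := z k) (k := k) (t := t) (hmono Z) (hmem Z) fun s _ => by
        have := R.B_eq k hz
        change R.N k z ≤ _
        linarith [hBz k]
      exact h.trans (mul_le_of_le_one_right (hz.1 k) (one_sub_exp_mem (R.beta_pos k)).2)
    exact fun k => hleast Z hZ t k
  · intro t ht k
    rw [hfix, picard, max_eq_left ht]
    have := intervalIntegral.integral_comp_sub_left (a := 0) (b := t)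
      (fun s => Real.exp (-R.beta k * (t - s)) * R.N k (c V s)) t
    simpa using this

/-! ### Regularity, strict bounds and limit of the flow -/

namespace IsFlow

variable {V : ℝ → Fin n → ℝ}

/-- The solution of `W' = N(V) - β W`, `W(0) = 0`, which extends the flow smoothly to
negative times. -/
def extend (R : Rates n) (V : ℝ → Fin n → ℝ) (t : ℝ) (k : Fin n) : ℝ :=
  Real.exp (-R.beta k * t) * ∫ s in (0 : ℝ)..t, Real.exp (R.beta k * s) * R.N k (V s)

lemma extend_eq (hV : R.IsFlow V) {t : ℝ} (ht : 0 ≤ t) : extend R V t = V t := by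
  funext k
  rw [hV.integral_eq t ht k, extend, ← intervalIntegral.integral_const_mul]
  refine intervalIntegral.integral_congr fun s _ => ?_
  simp only [← mul_assoc, ← Real.exp_add]
  ring_nf

lemma continuous_extend (hV : R.IsFlow V) : Continuous (extend R V) := by
  refine continuous_pi fun k => Continuous.mul (by fun_prop) ?_
  refine intervalIntegral.continuous_primitive (fun a b => ?_) 0
  refine Monotone.intervalIntegrable fun s t hst => ?_
  exact mul_le_mul (Real.exp_le_exp.2 (mul_le_mul_of_nonneg_left hst (R.beta_pos k).le))
    (monotone_N_comp k hV.mono hV.mem hst) (R.N_nonneg k (hV.mem _).1) (Real.exp_pos _).le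

/-- The integral equation upgrades monotonicity to continuity: for nonnegative times the flow is a
smooth factor times a primitive. -/
lemma continuous (hV : R.IsFlow V) : Continuous V := by
  have h : V = fun t => extend R V (max t 0) := by
    funext t
    rw [hV.extend_eq (le_max_right t 0)]
    rcases le_total t 0 with ht | ht
    · rw [max_eq_right ht, hV.eq_zero t ht, hV.eq_zero 0 le_rfl]
    · rw [max_eq_left ht]
  rw [h]
  exact hV.continuous_extend.comp (by fun_prop)

lemma continuous_comp (hV : R.IsFlow V) {f : (Fin n → ℝ) → ℝ} (hf : ContinuousOn f (Icc 0 1)) :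
    Continuous fun t => f (V t) :=
  hf.comp_continuous hV.continuous hV.mem

lemma hasDerivAt_extend (hV : R.IsFlow V) (t : ℝ) (k : Fin n) :
    HasDerivAt (fun t => extend R V t k) (R.N k (V t) - R.beta k * extend R V t k) t := by
  have hc : Continuous fun s => Real.exp (R.beta k * s) * R.N k (V s) :=
    Continuous.mul (by fun_prop) (hV.continuous_comp (R.continuousOn_N k))
  have h1 := intervalIntegral.integral_hasDerivAt_right (hc.intervalIntegrable 0 t)
    (hc.stronglyMeasurableAtFilter _ _) hc.continuousAt
  have h2 := ((hasDerivAt_id t).const_mul (-R.beta k)).exp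
  refine (h2.mul h1).congr_deriv ?_
  have h3 : Real.exp (-R.beta k * t) * Real.exp (R.beta k * t) = 1 := by
    rw [← Real.exp_add]; simp
  simp only [id_eq, mul_one, extend]
  rw [← mul_assoc (Real.exp _) (Real.exp _), h3]
  ring

lemma hasDerivAt_extend_of_nonneg (hV : R.IsFlow V) {t : ℝ} (ht : 0 ≤ t) (k : Fin n) :
    HasDerivAt (fun t => extend R V t k) (R.B k (V t)) t := by
  refine (hV.hasDerivAt_extend t k).congr_deriv ?_
  rw [R.B_eq k (hV.mem t), hV.extend_eq ht]

lemma hasDerivWithinAt (hV : R.IsFlow V) {t : ℝ} (ht : 0 ≤ t) (k : Fin n) :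
    HasDerivWithinAt (fun t => V t k) (R.B k (V t)) (Ici 0) t :=
  (hV.hasDerivAt_extend_of_nonneg ht k).hasDerivWithinAt.congr
    (fun s hs => by rw [hV.extend_eq hs]) (by rw [hV.extend_eq ht])

lemma hasDerivAt (hV : R.IsFlow V) {t : ℝ} (ht : 0 < t) (k : Fin n) :
    HasDerivAt (fun t => V t k) (R.B k (V t)) t :=
  (hV.hasDerivWithinAt ht.le k).hasDerivAt (Ici_mem_nhds ht)

/-- Along the flow `N_k(V(s)) ≤ N_k(V(t))` for `s ≤ t`, so this factor can be pulled out of the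
integral equation. The gain `1 - exp(-β_k t)` yields all strict inequalities for the flow: positive
speed, `V < 1`, and `V_k < q_k` where `q_k > 0`. -/
lemma le_N_mul (hV : R.IsFlow V) {t : ℝ} (ht : 0 ≤ t) (k : Fin n) :
    R.beta k * V t k ≤ R.N k (V t) * (1 - Real.exp (-R.beta k * t)) := by
  have hβ := R.beta_pos k
  have hle : (∫ s in (0 : ℝ)..t, Real.exp (R.beta k * s) * R.N k (V s))
      ≤ ∫ s in (0 : ℝ)..t, Real.exp (R.beta k * s) * R.N k (V t) := by
    refine intervalIntegral.integral_mono_on ht ?_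
      (Continuous.intervalIntegrable (by fun_prop) _ _) fun s hs => ?_
    · exact (Continuous.mul (by fun_prop)
        (hV.continuous_comp (R.continuousOn_N k))).intervalIntegrable _ _
    · exact mul_le_mul_of_nonneg_left (monotone_N_comp k hV.mono hV.mem hs.2) (Real.exp_pos _).le
  have h2 : (∫ s in (0 : ℝ)..t, Real.exp (R.beta k * s) * R.N k (V t))
      = R.N k (V t) / R.beta k * (Real.exp (R.beta k * t) - 1) := by
    have h := integral_beta_mul_exp (-R.beta k) t
    simp only [neg_neg, intervalIntegral.integral_const_mul] at h
    rw [intervalIntegral.integral_mul_const]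
    field_simp
    linear_combination -R.N k (V t) * h
  rw [h2] at hle
  rw [← hV.extend_eq ht, extend]
  have h3 := mul_le_mul_of_nonneg_left hle (mul_pos hβ (Real.exp_pos (-R.beta k * t))).le
  have h4 : Real.exp (-R.beta k * t) * Real.exp (R.beta k * t) = 1 := by
    rw [← Real.exp_add]; simp
  rw [hV.extend_eq ht]
  calc _ = R.beta k * Real.exp (-R.beta k * t) *
        ∫ s in (0 : ℝ)..t, Real.exp (R.beta k * s) * R.N k (V s) := by ring
    _ ≤ _ := h3
    _ = R.N k (V t) *
        (Real.exp (-R.beta k * t) * Real.exp (R.beta k * t) - Real.exp (-R.beta k * t)) := by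
      field_simp
    _ = _ := by rw [h4]

lemma N_mul_exp_le_B (hV : R.IsFlow V) {t : ℝ} (ht : 0 ≤ t) (k : Fin n) :
    R.N k 0 * Real.exp (-R.beta k * t) ≤ R.B k (V t) := by
  have h1 := hV.le_N_mul ht k
  have h2 := R.N_mono k le_rfl (hV.mem t).1 (hV.mem t).2
  rw [R.B_eq k (hV.mem t)]
  nlinarith [Real.exp_pos (-R.beta k * t)]

lemma B_zero_pos [NeZero n] (hV : R.IsFlow V) (hB : 0 < R.B 0 0) {t : ℝ} (ht : 0 ≤ t) :
    0 < R.B 0 (V t) := by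
  refine lt_of_lt_of_le ?_ (hV.N_mul_exp_le_B ht 0)
  rw [R.N_zero]
  exact mul_pos hB (Real.exp_pos _)

lemma lt_one (hV : R.IsFlow V) (t : ℝ) (k : Fin n) : V t k < 1 := by
  rcases le_total t 0 with ht | ht
  · rw [hV.eq_zero t ht]; simp
  · have h1 := hV.le_N_mul ht k
    have h2 := R.N_le_beta k (hV.mem t)
    have h3 := Real.exp_pos (-R.beta k * t)
    have h4 : Real.exp (-R.beta k * t) ≤ 1 :=
      Real.exp_le_one_iff.2 (by nlinarith [R.beta_pos k])
    have h5 : R.beta k * V t k < R.beta k * 1 := by nlinarith [R.beta_pos k]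
    exact lt_of_mul_lt_mul_left h5 (R.beta_pos k).le

/-- The flow converges to the smallest zero of the vector field in the unit cube. -/
theorem exists_isLeast_zeros (hV : R.IsFlow V) :
    ∃ q, IsLeast R.zeros q ∧ Tendsto V atTop (𝓝 q) ∧
      ∀ z ∈ Icc (0 : Fin n → ℝ) 1, (∀ k, R.B k z ≤ 0) → q ≤ z := by
  set q : Fin n → ℝ := fun k => ⨆ t, V t k
  have hlim : Tendsto V atTop (𝓝 q) := by
    refine tendsto_pi_nhds.2 fun k => tendsto_atTop_ciSup (fun s t hst => hV.mono hst k) ?_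
    exact ⟨1, by rintro _ ⟨t, rfl⟩; exact (hV.mem t).2 k⟩
  have hle : ∀ z ∈ Icc (0 : Fin n → ℝ) 1, (∀ k, R.B k z ≤ 0) → q ≤ z :=
    fun z hz hBz => le_of_tendsto' hlim fun t => hV.le_of_B_nonpos z hz hBz t
  have hq : q ∈ Icc (0 : Fin n → ℝ) 1 := isClosed_Icc.mem_of_tendsto hlim
    (Eventually.of_forall hV.mem)
  refine ⟨q, ⟨⟨hq, fun k => ?_⟩, fun z hz => hle z hz.1 fun k => (hz.2 k).le⟩, hlim, hle⟩
  -- The mean value theorem on `[t, t+1]` finds times at which `B_k(V)` equals an increment of the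
  -- convergent `V_k`; hence `B_k(q) = 0`.
  have hmvt : ∀ t : ℝ, ∃ s, t ≤ s ∧ (0 ≤ t → R.B k (V s) = V (t + 1) k - V t k) := by
    intro t
    by_cases ht : 0 ≤ t
    · obtain ⟨s, hs, h⟩ := exists_hasDerivAt_eq_slope (fun t => V t k) (fun t => R.B k (V t))
        (lt_add_one t) ((continuous_apply k).comp hV.continuous).continuousOn
        fun s hs => hV.hasDerivAt (ht.trans_lt hs.1) k
      exact ⟨s, hs.1.le, fun _ => by simpa using h⟩
    · exact ⟨t, le_rfl, fun h => absurd h ht⟩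
  choose s hs hsB using hmvt
  have hst : Tendsto s atTop atTop := tendsto_atTop_mono hs tendsto_id
  have h1 : Tendsto (fun t => R.B k (V (s t))) atTop (𝓝 (R.B k q)) := by
    have hw : Tendsto V atTop (𝓝[Icc 0 1] q) :=
      tendsto_nhdsWithin_iff.2 ⟨hlim, Eventually.of_forall hV.mem⟩
    exact ((R.continuousOn_B k q hq).tendsto.comp hw).comp hst
  have h2 : Tendsto (fun t => V (t + 1) k - V t k) atTop (𝓝 0) := by
    have hk := tendsto_pi_nhds.1 hlim k
    simpa using (hk.comp (tendsto_atTop_add_const_right _ 1 tendsto_id)).sub hk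
  refine tendsto_nhds_unique h1 (h2.congr' ?_)
  filter_upwards [eventually_ge_atTop 0] with t ht
  rw [hsB t ht]

end IsFlow

end Rates

/-! ### Absorption probabilities of the Feller minimal `Q`-function -/

section Feller

variable {I : Type} {Q : I → I → ℝ} {o : I}

open Classical in
/-- The off-diagonal rates as extended nonnegative numbers. -/
def offRate (Q : I → I → ℝ) (i k : I) : ℝ≥0∞ := if k = i then 0 else ENNReal.ofReal (Q i k)

open Classical in
lemma fellerIter_succ (Q : I → I → ℝ) (m : ℕ) (t : ℝ) (i j : I) :
    fellerIter Q (m + 1) t i j = (if i = j then ENNReal.ofReal (Real.exp (Q i i * t)) else 0) +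
      ∫⁻ s in Icc 0 t, ENNReal.ofReal (Real.exp (Q i i * s)) *
        ∑' k, offRate Q i k * fellerIter Q m (t - s) k j := rfl

lemma fellerIter_absorbing (ho : ∀ k, Q o k = 0) (m : ℕ) (t : ℝ) :
    fellerIter Q (m + 1) t o o = 1 := by
  have h : ∀ k, offRate Q o k = 0 := fun k => by simp [offRate, ho]
  simp [fellerIter_succ, ho, h]

/-- Absorption is essential: at `o` every iterate after the first is constantly `1`, and elsewhere
the decaying exponential term is absent. -/
lemma monotone_fellerIter_time (ho : ∀ k, Q o k = 0) (m : ℕ) (i : I) :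
    Monotone fun t => fellerIter Q m t i o := by
  induction m generalizing i with
  | zero => exact fun _ _ _ => le_rfl
  | succ m ih =>
    intro t t' h
    by_cases hi : i = o
    · subst hi
      simp [fellerIter_absorbing ho]
    · simp only [fellerIter_succ, hi, if_false, zero_add]
      refine (lintegral_mono_set (Icc_subset_Icc_right h)).trans (lintegral_mono fun s => ?_)
      exact mul_le_mul_right (ENNReal.tsum_le_tsum fun k => mul_le_mul_right
        (ih k (sub_le_sub_right h s)) _) _

lemma monotone_fellerIter_index (Q : I → I → ℝ) (t : ℝ) (i j : I) :
    Monotone fun m => fellerIter Q m t i j := by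
  refine monotone_nat_of_le_succ fun m => ?_
  induction m generalizing t i with
  | zero => exact zero_le
  | succ m ih =>
    rw [fellerIter_succ, fellerIter_succ]
    refine add_le_add_right (lintegral_mono fun s => ?_) _
    exact mul_le_mul_right (ENNReal.tsum_le_tsum fun k => mul_le_mul_right (ih _ k) _) _

lemma lintegral_exp_mul {c T : ℝ} (hc : c ≤ 0) (hT : 0 ≤ T) :
    ∫⁻ s in Icc 0 T, ENNReal.ofReal (Real.exp (c * s)) * ENNReal.ofReal (-c)
      = ENNReal.ofReal (1 - Real.exp (c * T)) := by
  have h := Rates.integral_beta_mul_exp (-c) T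
  simp only [neg_neg] at h
  rw [← h, intervalIntegral.integral_of_le hT, ← integral_Icc_eq_integral_Ioc,
    ofReal_integral_eq_lintegral_ofReal]
  · refine lintegral_congr fun s => ?_
    rw [← ENNReal.ofReal_mul (Real.exp_pos _).le, mul_comm]
  · exact (Continuous.integrableOn_Icc (by fun_prop))
  · exact Eventually.of_forall fun s => mul_nonneg (neg_nonneg.2 hc) (Real.exp_pos _).le

/-- The absorption probability at `o` lies below every supersolution of the backward system. -/
lemma fellerIter_le (ho : ∀ k, Q o k = 0) (hq : ∀ i, Q i i ≤ 0) {x : I → ℝ≥0∞} (hx : 1 ≤ x o)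
    (hsup : ∀ i, i ≠ o → ∑' k, offRate Q i k * x k ≤ ENNReal.ofReal (-Q i i) * x i)
    (m : ℕ) (t : ℝ) (i : I) : fellerIter Q m t i o ≤ x i := by
  induction m generalizing t i with
  | zero => exact zero_le
  | succ m ih =>
    by_cases hi : i = o
    · subst hi
      rwa [fellerIter_absorbing ho]
    · simp only [fellerIter_succ, hi, if_false, zero_add]
      rcases lt_or_ge t 0 with ht | ht
      · simp [Icc_eq_empty_of_lt ht]
      · calc _ ≤ ∫⁻ s in Icc 0 t, ENNReal.ofReal (Real.exp (Q i i * s)) *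
                ENNReal.ofReal (-Q i i) * x i := by
              refine lintegral_mono fun s => ?_
              rw [mul_assoc]
              exact mul_le_mul_right ((ENNReal.tsum_le_tsum fun k => mul_le_mul_right
                (ih _ k) _).trans (hsup i hi)) _
          _ = ENNReal.ofReal (1 - Real.exp (Q i i * t)) * x i := by
              rw [lintegral_mul_const _ (by fun_prop), lintegral_exp_mul (hq i) ht]
          _ ≤ 1 * x i := by
              refine mul_le_mul_left ?_ _
              rw [ENNReal.ofReal_le_one]
              linarith [Real.exp_pos (Q i i * t)]
          _ = x i := one_mul _

/-- The limit of `p_{io}(t)` as `t → ∞`, for an absorbing state `o`. -/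
def absorption (Q : I → I → ℝ) (o i : I) : ℝ≥0∞ := ⨆ t, fellerMinimal Q t i o

lemma tendsto_absorption (ho : ∀ k, Q o k = 0) (i : I) :
    Tendsto (fun t => fellerMinimal Q t i o) atTop (𝓝 (absorption Q o i)) :=
  tendsto_atTop_iSup fun _ _ h => iSup_mono fun m => monotone_fellerIter_time ho m i h

lemma fellerIter_le_absorption (m : ℕ) (t : ℝ) (i : I) :
    fellerIter Q m t i o ≤ absorption Q o i :=
  (le_iSup (fun m => fellerIter Q m t i o) m).trans (le_iSup (fun t => fellerMinimal Q t i o) t)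

lemma absorption_le (ho : ∀ k, Q o k = 0) (hq : ∀ i, Q i i ≤ 0) {x : I → ℝ≥0∞} (hx : 1 ≤ x o)
    (hsup : ∀ i, i ≠ o → ∑' k, offRate Q i k * x k ≤ ENNReal.ofReal (-Q i i) * x i) (i : I) :
    absorption Q o i ≤ x i :=
  iSup_le fun t => iSup_le fun m => fellerIter_le ho hq hx hsup m t i

lemma one_le_absorption_self (ho : ∀ k, Q o k = 0) : 1 ≤ absorption Q o o :=
  (fellerIter_absorbing ho 0 0).symm.le.trans (fellerIter_le_absorption 1 0 o)

/-- Joint monotonicity in index and time reduces the double supremum to a single sequence. -/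
lemma tendsto_fellerIter_diag (ho : ∀ k, Q o k = 0) (i : I) :
    Tendsto (fun m : ℕ => fellerIter Q m m i o) atTop (𝓝 (absorption Q o i)) := by
  have hmono : Monotone fun m : ℕ => fellerIter Q m m i o := fun m m' h =>
    (monotone_fellerIter_index Q m i o h).trans
      (monotone_fellerIter_time ho m' i (Nat.cast_le.2 h))
  have h : absorption Q o i = ⨆ m : ℕ, fellerIter Q m m i o := by
    refine le_antisymm (iSup_le fun t => iSup_le fun m => ?_)
      (iSup_le fun m => fellerIter_le_absorption m m i)
    refine le_iSup_of_le (max m ⌈t⌉₊) ?_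
    refine (monotone_fellerIter_index Q t i o (le_max_left m ⌈t⌉₊)).trans
      (monotone_fellerIter_time ho _ i ?_)
    exact (Nat.le_ceil t).trans (Nat.cast_le.2 (le_max_right _ _))
  rw [h]
  exact tendsto_atTop_iSup hmono

/-- The absorption probabilities solve the backward system (the inequality needed here). -/
lemma tsum_offRate_mul_absorption_le (ho : ∀ k, Q o k = 0) {i : I} (hi : i ≠ o)
    (hq : Q i i < 0) :
    ∑' k, offRate Q i k * absorption Q o k ≤ ENNReal.ofReal (-Q i i) * absorption Q o i := by
  have hstep : ∀ m : ℕ, ENNReal.ofReal (1 - Real.exp (Q i i * m)) *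
      ∑' k, offRate Q i k * fellerIter Q m m k o ≤
        ENNReal.ofReal (-Q i i) * absorption Q o i := by
    intro m
    have hm : (0 : ℝ) ≤ m := Nat.cast_nonneg m
    -- With total time `2m`, restricting the first holding time to `[0, m]` leaves at least time `m`
    -- afterwards.
    refine le_trans ?_ (mul_le_mul_right (fellerIter_le_absorption (m + 1) ((m : ℝ) + m) i) _)
    simp only [fellerIter_succ, hi, if_false, zero_add]
    rw [← lintegral_exp_mul hq.le hm, lintegral_mul_const _ (by fun_prop), mul_comm _
      (ENNReal.ofReal (-Q i i)), mul_assoc, ← lintegral_mul_const _ (by fun_prop)]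
    refine mul_le_mul_right ?_ _
    refine le_trans ?_ (lintegral_mono_set (Icc_subset_Icc_right (le_add_of_nonneg_left hm)))
    refine setLIntegral_mono' measurableSet_Icc fun s hs => ?_
    exact mul_le_mul_right (ENNReal.tsum_le_tsum fun k => mul_le_mul_right
      (monotone_fellerIter_time ho m k (by linarith [hs.2])) _) _
  -- Finite partial sums allow the limit in `m` to be taken termwise.
  rw [ENNReal.tsum_eq_iSup_sum]
  refine iSup_le fun F => ?_
  have h1 : Tendsto (fun m : ℕ => ENNReal.ofReal (1 - Real.exp (Q i i * m)) *
      ∑ k ∈ F, offRate Q i k * fellerIter Q m m k o) atTop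
      (𝓝 (1 * ∑ k ∈ F, offRate Q i k * absorption Q o k)) := by
    refine ENNReal.Tendsto.mul ?_ (Or.inl one_ne_zero) ?_ (Or.inr ENNReal.one_ne_top)
    · have : Tendsto (fun m : ℕ => 1 - Real.exp (Q i i * m)) atTop (𝓝 (1 - 0)) := by
        refine Tendsto.const_sub _ (Real.tendsto_exp_atBot.comp ?_)
        exact tendsto_natCast_atTop_atTop.const_mul_atTop_of_neg hq
      rw [sub_zero] at this
      simpa using ENNReal.tendsto_ofReal this
    · refine tendsto_finsetSum _ fun k _ => ?_
      refine ENNReal.Tendsto.const_mul (tendsto_fellerIter_diag ho k) (Or.inr ?_)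
      unfold offRate
      split_ifs <;> simp
  rw [one_mul] at h1
  refine le_of_tendsto' h1 fun m => le_trans ?_ (hstep m)
  exact mul_le_mul_right (ENNReal.sum_le_tsum F) _

end Feller

/-! ### Extinction probabilities and the maximum principle -/

namespace Rates

variable {n : ℕ} (R : Rates n)

/-- Translates between signed real row sums and the off-diagonal sums in `[0, ∞]`, by moving the
diagonal term across. -/
lemma tsum_offRate_mul {i : Fin n → ℕ} {x : (Fin n → ℕ) → ℝ} (hx : ∀ j, 0 ≤ x j) {S : ℝ}
    (hs : HasSum (fun j => R.qMatrix i j * x j) S) :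
    ∑' k, offRate R.qMatrix i k * ENNReal.ofReal (x k)
      = ENNReal.ofReal (S + -R.qMatrix i i * x i) := by
  classical
  have h1 := hs.sub (hasSum_ite_eq i (R.qMatrix i i * x i))
  have h2 : ∀ k, offRate R.qMatrix i k * ENNReal.ofReal (x k) = ENNReal.ofReal
      (R.qMatrix i k * x k - if k = i then R.qMatrix i i * x i else 0) := by
    intro k
    unfold offRate
    split_ifs with hk
    · subst hk; simp
    · rw [sub_zero, ENNReal.ofReal_mul (R.qMatrix_nonneg hk)]
  simp_rw [h2]
  rw [← ENNReal.ofReal_tsum_of_nonneg ?_ h1.summable, h1.tsum_eq]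
  · congr 1; ring
  · intro k
    split_ifs with hk
    · subst hk; simp
    · rw [sub_zero]; exact mul_nonneg (R.qMatrix_nonneg hk) (hx k)

lemma qMatrix_self_nonpos (i : Fin n → ℕ) : R.qMatrix i i ≤ 0 := by
  by_cases hi : i = 0
  · subst hi; simp [qMatrix_zero]
  · exact (R.qMatrix_self_neg hi).le

/-- The extinction probability from `i`. -/
def extinction (i : Fin n → ℕ) : ℝ≥0∞ := absorption R.qMatrix 0 i

lemma extinction_le_ofReal {x : (Fin n → ℕ) → ℝ} (hx : ∀ j, 0 ≤ x j) (hx0 : 1 ≤ x 0)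
    (hQ : ∀ i, i ≠ 0 → ∃ S ≤ 0, HasSum (fun j => R.qMatrix i j * x j) S) (i : Fin n → ℕ) :
    R.extinction i ≤ ENNReal.ofReal (x i) := by
  refine absorption_le (x := fun i => ENNReal.ofReal (x i)) R.qMatrix_zero R.qMatrix_self_nonpos
    (by simpa using hx0) (fun i hi => ?_) i
  obtain ⟨S, hS, hsum⟩ := hQ i hi
  rw [R.tsum_offRate_mul hx hsum, ← ENNReal.ofReal_mul (neg_nonneg.2 (R.qMatrix_self_nonpos i))]
  exact ENNReal.ofReal_le_ofReal (by linarith)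

lemma extinction_le_one (i : Fin n → ℕ) : R.extinction i ≤ 1 := by
  have := R.extinction_le_ofReal (x := fun _ => 1) (fun _ => zero_le_one) le_rfl
    (fun i hi => ⟨0, le_rfl, by simpa using R.hasSum_qMatrix hi⟩) i
  simpa using this

lemma extinction_zero : R.extinction 0 = 1 :=
  le_antisymm (R.extinction_le_one 0) (one_le_absorption_self R.qMatrix_zero)

lemma extinction_ne_top (i : Fin n → ℕ) : R.extinction i ≠ ⊤ :=
  ((R.extinction_le_one i).trans_lt ENNReal.one_lt_top).ne

lemma summable_qMatrix_mul (R : Rates n) {i : Fin n → ℕ} (hi : i ≠ 0) {x : (Fin n → ℕ) → ℝ}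
    {C : ℝ} (hx : ∀ j, |x j| ≤ C) : Summable fun j => R.qMatrix i j * x j := by
  refine Summable.of_norm_bounded ((R.hasSum_qMatrix hi).summable.abs.mul_right C) fun j => ?_
  rw [norm_mul]
  exact mul_le_mul_of_nonneg_left (hx j) (abs_nonneg _)

lemma tsum_qMatrix_mul_extinction_nonpos {i : Fin n → ℕ} (hi : i ≠ 0) :
    ∑' j, R.qMatrix i j * (R.extinction j).toReal ≤ 0 := by
  have h0 : ∀ j, 0 ≤ (R.extinction j).toReal := fun j => ENNReal.toReal_nonneg
  have h1 : ∀ j, |(R.extinction j).toReal| ≤ 1 := fun j => by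
    rw [abs_of_nonneg (h0 j)]
    exact ENNReal.toReal_le_of_le_ofReal zero_le_one (by simpa using R.extinction_le_one j)
  have h2 := R.tsum_offRate_mul h0 (R.summable_qMatrix_mul hi h1).hasSum
  have h3 := tsum_offRate_mul_absorption_le R.qMatrix_zero hi (R.qMatrix_self_neg hi)
  change ∑' k, offRate R.qMatrix i k * R.extinction k ≤
    ENNReal.ofReal (-R.qMatrix i i) * R.extinction i at h3
  have hq : 0 ≤ -R.qMatrix i i := neg_nonneg.2 (R.qMatrix_self_nonpos i)
  simp only [ENNReal.ofReal_toReal (R.extinction_ne_top _)] at h2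
  rw [h2, ← ENNReal.ofReal_toReal (R.extinction_ne_top i), ← ENNReal.ofReal_mul hq,
    ENNReal.ofReal_le_ofReal_iff (mul_nonneg hq (h0 i)),
    ENNReal.toReal_ofReal (h0 i)] at h3
  linarith

/-- A maximum principle: a bounded subsolution of the backward system which is nonpositive at `0`
and asymptotically nonpositive is nonpositive. -/
theorem nonpos_of_subsolution {d : (Fin n → ℕ) → ℝ} (h0 : d 0 ≤ 0)
    (hQ : ∀ i, i ≠ 0 → Summable (fun j => R.qMatrix i j * d j) ∧ 0 ≤ ∑' j, R.qMatrix i j * d j)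
    (hfin : ∀ ε > 0, {i | ε ≤ d i}.Finite) (i : Fin n → ℕ) : d i ≤ 0 := by
  by_contra! hi
  -- A positive value has a finite superlevel set, so the supremum is attained.
  obtain ⟨j, hj, hjmax⟩ := (hfin _ hi).exists_maximalFor d _ ⟨i, le_refl (d i)⟩
  have hjpos : 0 < d j := lt_of_lt_of_le hi hj
  have hle : ∀ k, d k ≤ d j := by
    intro k
    by_contra! hk
    exact hk.not_ge (hjmax (le_trans (show d i ≤ d j from hj) hk.le) hk.le)
  -- Among the finitely many maximisers, one with the largest population is chosen. The row equation
  -- forces every state reachable in one jump to be a maximiser as well, and an immigration jump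
  -- gives a larger one.
  obtain ⟨l, hl, hlmax⟩ := (hfin _ hjpos).exists_maximalFor (fun k => ∑ r, k r) _ ⟨j, le_refl (d j)⟩
  have hlj : d l = d j := le_antisymm (hle l) hl
  have hl0 : l ≠ 0 := by
    rintro rfl
    linarith
  obtain ⟨hs, hnn⟩ := hQ l hl0
  have h1 := hs.hasSum.sub ((R.hasSum_qMatrix hl0).mul_right (d l))
  rw [zero_mul, sub_zero] at h1
  have h2 : ∀ k, R.qMatrix l k * d k - R.qMatrix l k * d l ≤ 0 := by
    intro k
    by_cases hk : k = l
    · subst hk; simp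
    · rw [← mul_sub]
      exact mul_nonpos_of_nonneg_of_nonpos (R.qMatrix_nonneg hk) (by linarith [hle k])
  have h3 : ∀ k, R.qMatrix l k * d k - R.qMatrix l k * d l = 0 := by
    have h4 := h1.neg
    have h5 : HasSum (fun k => -(R.qMatrix l k * d k - R.qMatrix l k * d l)) 0 := by
      have : -∑' j, R.qMatrix l j * d j = 0 :=
        le_antisymm (neg_nonpos.2 hnn) (h4.nonneg fun k => neg_nonneg.2 (h2 k))
      rwa [this] at h4
    intro k
    have h6 := congrFun ((hasSum_zero_iff_of_nonneg fun k => neg_nonneg.2 (h2 k)).1 h5) k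
    simpa only [Pi.zero_apply, neg_eq_zero] using h6
  obtain ⟨m, hm, hpos⟩ := R.exists_a_pos
  have hq : 0 < R.qMatrix l (l + m) := hpos.trans_le (R.a_le_qMatrix_add hl0 hm)
  have h7 := h3 (l + m)
  rw [← mul_sub] at h7
  have h8 : d (l + m) = d l := by
    linarith [(mul_eq_zero.1 h7).resolve_left hq.ne']
  have h9 := hlmax (j := l + m) (by
    change d j ≤ d (l + m); rw [h8, hlj]) (by simp [Finset.sum_add_distrib])
  obtain ⟨r, hr⟩ := Function.ne_iff.1 hm
  have h10 : 0 < ∑ r, m r := Finset.sum_pos' (fun _ _ => Nat.zero_le _)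
    ⟨r, Finset.mem_univ r, Nat.pos_of_ne_zero hr⟩
  simp [Finset.sum_add_distrib] at h9
  exact hr (h9 r)

end Rates

/-- Strictness is required only in coordinates with `v k > 0`; positivity of the monomial ensures
that each coordinate occurring in it is of this kind. -/
lemma monomial_lt {n : ℕ} {m : Fin n → ℕ} (hm : m ≠ 0) {u v : Fin n → ℝ} (hu : 0 ≤ u)
    (huv : u ≤ v) (hlt : ∀ k, 0 < v k → u k < v k) (hpos : 0 < monomial m v) :
    monomial m u < monomial m v := by
  classical
  obtain ⟨k, hk⟩ := Function.ne_iff.1 hm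
  have hk : m k ≠ 0 := hk
  have hv : 0 ≤ v := hu.trans huv
  have hvk : 0 < v k := by
    refine lt_of_le_of_ne (hv k) fun h0 => hpos.ne' ?_
    exact Finset.prod_eq_zero (Finset.mem_univ k) (by simp [← h0, hk])
  simp only [monomial] at hpos ⊢
  rw [← Finset.mul_prod_erase _ _ (Finset.mem_univ k)] at hpos ⊢
  rw [← Finset.mul_prod_erase _ _ (Finset.mem_univ k)]
  have h1 : ∏ x ∈ Finset.univ.erase k, u x ^ m x ≤ ∏ x ∈ Finset.univ.erase k, v x ^ m x :=
    Finset.prod_le_prod (fun l _ => pow_nonneg (hu l) _)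
      fun l _ => pow_le_pow_left₀ (hu l) (huv l) _
  have h2 : 0 < ∏ x ∈ Finset.univ.erase k, v x ^ m x :=
    pos_of_mul_pos_right hpos (pow_nonneg (hv k) _)
  exact (mul_le_mul_of_nonneg_left h1 (pow_nonneg (hu k) _)).trans_lt
    (mul_lt_mul_of_pos_right (pow_lt_pow_left₀ (hlt k hvk) (hu k) hk) h2)

namespace Rates

variable {n : ℕ} {R : Rates n} {V : ℝ → Fin n → ℝ}

/-! ### Integrals along the flow -/

/-- `exp (∫₀ᵗ A(V(s)) ds)`. -/
def damping (R : Rates n) (V : ℝ → Fin n → ℝ) (t : ℝ) : ℝ :=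
  Real.exp (∫ s in (0 : ℝ)..t, R.A (V s))

/-- `∫₀ᵀ V(t)^i exp (∫₀ᵗ A(V(s)) ds) dt`. -/
def flowIntegral (R : Rates n) (V : ℝ → Fin n → ℝ) (T : ℝ) (i : Fin n → ℕ) : ℝ :=
  ∫ t in (0 : ℝ)..T, monomial i (V t) * R.damping V t

/-- `∫₀^∞ V(t)^i exp (∫₀ᵗ A(V(s)) ds) dt`. -/
def flowLIntegral (R : Rates n) (V : ℝ → Fin n → ℝ) (i : Fin n → ℕ) : ℝ≥0∞ :=
  ∫⁻ t in Ici 0, ENNReal.ofReal (monomial i (V t) * R.damping V t)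

lemma damping_pos (t : ℝ) : 0 < R.damping V t := Real.exp_pos _

namespace IsFlow

lemma hasDerivAt_damping (hV : R.IsFlow V) (t : ℝ) :
    HasDerivAt (R.damping V) (R.damping V t * R.A (V t)) t := by
  have hc := hV.continuous_comp R.continuousOn_A
  exact (intervalIntegral.integral_hasDerivAt_right (hc.intervalIntegrable 0 t)
    (hc.stronglyMeasurableAtFilter _ _) hc.continuousAt).exp

lemma continuous_damping (hV : R.IsFlow V) : Continuous (R.damping V) :=
  continuous_iff_continuousAt.2 fun t => (hV.hasDerivAt_damping t).continuousAt

lemma antitone_damping (hV : R.IsFlow V) : Antitone (R.damping V) :=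
  antitone_of_hasDerivAt_nonpos hV.hasDerivAt_damping fun t =>
    mul_nonpos_of_nonneg_of_nonpos (damping_pos t).le (R.A_nonpos (hV.mem t))

lemma damping_zero : R.damping V 0 = 1 := by simp [damping]

lemma damping_le_one (hV : R.IsFlow V) {t : ℝ} (ht : 0 ≤ t) : R.damping V t ≤ 1 :=
  (hV.antitone_damping ht).trans_eq damping_zero

lemma continuous_integrand (hV : R.IsFlow V) (i : Fin n → ℕ) :
    Continuous fun t => monomial i (V t) * R.damping V t :=
  ((continuous_monomial i).comp hV.continuous).mul hV.continuous_damping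

lemma integrand_nonneg (hV : R.IsFlow V) (i : Fin n → ℕ) (t : ℝ) :
    0 ≤ monomial i (V t) * R.damping V t :=
  mul_nonneg (monomial_nonneg i (hV.mem t).1) (damping_pos t).le

/-- The product rule, in the shape of the branching part of `hasSum_qMatrix_mul_monomial`. -/
lemma hasDerivAt_monomial (hV : R.IsFlow V) (i : Fin n → ℕ) {t : ℝ} (ht : 0 < t) :
    HasDerivAt (fun t => monomial i (V t))
      (∑ k, (i k : ℝ) * (monomial (i - Pi.single k 1) (V t) * R.B k (V t))) t := by
  classical
  have h := HasDerivAt.fun_finsetProd (u := Finset.univ)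
    fun k _ => ((hV.hasDerivAt ht k).fun_pow (i k))
  refine h.congr_deriv (Finset.sum_congr rfl fun k _ => ?_)
  have h1 : monomial (i - Pi.single k 1) (V t)
      = V t k ^ (i k - 1) * ∏ l ∈ Finset.univ.erase k, V t l ^ i l := by
    rw [monomial, ← Finset.mul_prod_erase _ _ (Finset.mem_univ k)]
    congr 1
    · simp
    · refine Finset.prod_congr rfl fun l hl => ?_
      simp [Finset.ne_of_mem_erase hl]
  rw [h1, smul_eq_mul]
  ring

/-- Integrating the backward operator along the flow. -/
lemma hasSum_qMatrix_mul_flowIntegral (hV : R.IsFlow V) {i : Fin n → ℕ} (hi : i ≠ 0) {T : ℝ}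
    (hT : 0 ≤ T) :
    HasSum (fun j => R.qMatrix i j * R.flowIntegral V T j)
      (monomial i (V T) * R.damping V T) := by
  -- The row generating function at `V(t)` times the damping, which is exactly the derivative of
  -- `V^i` times the damping.
  set f : ℝ → ℝ := fun t => (∑ k, (i k : ℝ) * (monomial (i - Pi.single k 1) (V t) * R.B k (V t)) +
    monomial i (V t) * R.A (V t)) * R.damping V t
  have hcm : ∀ m : Fin n → ℕ, Continuous fun t => monomial m (V t) :=
    fun m => (continuous_monomial m).comp hV.continuous
  have hf : Continuous f := by
    refine Continuous.mul (Continuous.add (continuous_finsetSum _ fun k _ => ?_) ?_)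
      hV.continuous_damping
    · exact continuous_const.mul ((hcm _).mul (hV.continuous_comp (R.continuousOn_B k)))
    · exact (hcm _).mul (hV.continuous_comp R.continuousOn_A)
  have hftc : ∫ t in (0 : ℝ)..T, f t = monomial i (V T) * R.damping V T := by
    rw [intervalIntegral.integral_eq_sub_of_hasDerivAt_of_le hT
      (f := fun t => monomial i (V t) * R.damping V t) (hV.continuous_integrand i).continuousOn
      (fun t ht => ?_) (hf.intervalIntegrable _ _)]
    · rw [hV.eq_zero 0 le_rfl, monomial_zero_right hi, zero_mul, sub_zero]
    · refine ((hV.hasDerivAt_monomial i ht.1).mul (hV.hasDerivAt_damping t)).congr_deriv ?_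
      simp only [f]
      ring
  rw [← hftc]
  have h := intervalIntegral.hasSum_integral_of_dominated_convergence (μ := volume)
    (a := 0) (b := T)
    (F := fun j t => R.qMatrix i j * (monomial j (V t) * R.damping V t)) (f := f)
    (fun j _ => |R.qMatrix i j|) (fun j => ?_) (fun j => ?_) ?_ ?_ ?_
  · simpa only [flowIntegral, intervalIntegral.integral_const_mul] using h
  · exact (continuous_const.mul (hV.continuous_integrand j)).aestronglyMeasurable
  · refine Eventually.of_forall fun t ht => ?_
    rw [uIoc_of_le hT] at ht
    rw [norm_mul, Real.norm_of_nonneg (hV.integrand_nonneg j t), Real.norm_eq_abs]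
    exact mul_le_of_le_one_right (abs_nonneg _) (mul_le_one₀ (monomial_le_one j (hV.mem t))
      (damping_pos t).le (hV.damping_le_one ht.1.le))
  · exact Eventually.of_forall fun t _ => (R.hasSum_qMatrix hi).summable.abs
  · exact intervalIntegrable_const
  · refine Eventually.of_forall fun t _ => ?_
    exact ((R.hasSum_qMatrix_mul_monomial hi (hV.mem t)).mul_right (R.damping V t)).congr_fun
      fun j => by ring

lemma flowIntegral_nonneg (hV : R.IsFlow V) {T : ℝ} (hT : 0 ≤ T) (i : Fin n → ℕ) :
    0 ≤ R.flowIntegral V T i :=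
  intervalIntegral.integral_nonneg hT fun t _ => hV.integrand_nonneg i t

lemma flowIntegral_zero_pos (hV : R.IsFlow V) {T : ℝ} (hT : 0 < T) :
    0 < R.flowIntegral V T 0 := by
  refine intervalIntegral.intervalIntegral_pos_of_pos
    ((hV.continuous_integrand 0).intervalIntegrable _ _) (fun t => ?_) hT
  rw [monomial_zero_left, one_mul]
  exact damping_pos t

/-- Since `V` is increasing, its final value bounds the integrand; this gives the decay in `i`
required by the maximum principle. -/
lemma flowIntegral_le (hV : R.IsFlow V) {T : ℝ} (hT : 0 ≤ T) (i : Fin n → ℕ) :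
    R.flowIntegral V T i ≤ monomial i (V T) * R.flowIntegral V T 0 := by
  rw [flowIntegral, flowIntegral, ← intervalIntegral.integral_const_mul]
  refine intervalIntegral.integral_mono_on hT ((hV.continuous_integrand i).intervalIntegrable _ _)
    ((continuous_const.mul (hV.continuous_integrand 0)).intervalIntegrable _ _) fun t ht => ?_
  rw [monomial_zero_left, one_mul]
  exact mul_le_mul_of_nonneg_right (monomial_mono i (hV.mem t).1 (hV.mono ht.2)) (damping_pos t).le

lemma flowIntegral_le_flowIntegral_zero (hV : R.IsFlow V) {T : ℝ} (hT : 0 ≤ T) (i : Fin n → ℕ) :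
    R.flowIntegral V T i ≤ R.flowIntegral V T 0 :=
  (hV.flowIntegral_le hT i).trans
    (mul_le_of_le_one_left (hV.flowIntegral_nonneg hT 0) (monomial_le_one i (hV.mem T)))

/-- The integrals up to a finite time give a lower bound for the extinction probability. -/
theorem flowIntegral_div_le_extinction (hV : R.IsFlow V) {T : ℝ} (hT : 0 < T) (i : Fin n → ℕ) :
    R.flowIntegral V T i / R.flowIntegral V T 0 ≤ (R.extinction i).toReal := by
  have hK := hV.flowIntegral_zero_pos hT
  rw [← sub_nonpos]
  have ha : ∀ j, |(R.extinction j).toReal| ≤ 1 := fun j => by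
    rw [abs_of_nonneg ENNReal.toReal_nonneg]
    exact ENNReal.toReal_le_of_le_ofReal zero_le_one (by simpa using R.extinction_le_one j)
  refine R.nonpos_of_subsolution (d := fun i => R.flowIntegral V T i / R.flowIntegral V T 0 -
    (R.extinction i).toReal) ?_ (fun i hi => ?_) (fun ε hε => ?_) i
  · simp [hK.ne', R.extinction_zero]
  · have h1 := (hV.hasSum_qMatrix_mul_flowIntegral hi hT.le).div_const (R.flowIntegral V T 0)
    have h2 := (R.summable_qMatrix_mul hi ha).hasSum
    have h3 := (h1.sub h2).congr_fun (g := fun j => R.qMatrix i j *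
      (R.flowIntegral V T j / R.flowIntegral V T 0 - (R.extinction j).toReal)) fun j => by ring
    refine ⟨h3.summable, ?_⟩
    rw [h3.tsum_eq]
    have h4 := R.tsum_qMatrix_mul_extinction_nonpos hi
    have h5 := div_nonneg (hV.integrand_nonneg i T) hK.le
    linarith
  -- The difference is at most `V(T)^i`, and all components of `V(T)` are below `1`; so states where
  -- it is at least `ε` lie in a box.
  · have hL : ∀ k, ∃ L, ∀ m, L ≤ m → V T k ^ m < ε := fun k =>
      eventually_atTop.1 ((tendsto_pow_atTop_nhds_zero_of_lt_one ((hV.mem T).1 k)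
        (hV.lt_one T k)).eventually_lt_const hε)
    choose L hL using hL
    refine (Set.finite_Iic L).subset fun i hi k => ?_
    by_contra! hk
    have h1 := hL k (i k) hk.le
    have h2 := (monomial_le_pow i (hV.mem T) k).trans_lt h1
    have h3 : R.flowIntegral V T i / R.flowIntegral V T 0 ≤ monomial i (V T) := by
      rw [div_le_iff₀ hK]
      exact hV.flowIntegral_le hT.le i
    have h4 : ε ≤ R.flowIntegral V T i / R.flowIntegral V T 0 - (R.extinction i).toReal := hi
    linarith [ENNReal.toReal_nonneg (a := R.extinction i)]

lemma flowLIntegral_zero_pos (hV : R.IsFlow V) : 0 < R.flowLIntegral V 0 := by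
  rw [flowLIntegral, lintegral_pos_iff_support
    (hV.continuous_integrand 0).measurable.ennreal_ofReal]
  have : Function.support (fun t => ENNReal.ofReal (monomial 0 (V t) * R.damping V t)) = univ := by
    ext t
    simp [monomial_zero_left, damping_pos]
  rw [this]
  simp

lemma integrableOn_of_flowLIntegral_ne_top (hV : R.IsFlow V) (h : R.flowLIntegral V 0 ≠ ⊤)
    (i : Fin n → ℕ) : IntegrableOn (fun t => monomial i (V t) * R.damping V t) (Ici 0) := by
  have h0 : IntegrableOn (fun t => monomial 0 (V t) * R.damping V t) (Ici 0) :=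
    (lintegral_ofReal_ne_top_iff_integrable
      (hV.continuous_integrand 0).aestronglyMeasurable
      (Eventually.of_forall (hV.integrand_nonneg 0))).1 h
  refine h0.mono' (hV.continuous_integrand i).aestronglyMeasurable
    (Eventually.of_forall fun t => ?_)
  rw [Real.norm_of_nonneg (hV.integrand_nonneg i t), monomial_zero_left]
  exact mul_le_mul_of_nonneg_right (monomial_le_one i (hV.mem t)) (damping_pos t).le

lemma flowLIntegral_ne_top (hV : R.IsFlow V) {C T₀ : ℝ}
    (h : ∀ T, T₀ ≤ T → R.flowIntegral V T 0 ≤ C) : R.flowLIntegral V 0 ≠ ⊤ := by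
  refine (lintegral_ofReal_ne_top_iff_integrable
      (hV.continuous_integrand 0).aestronglyMeasurable
      (Eventually.of_forall (hV.integrand_nonneg 0))).2 ?_
  have : IntegrableOn (fun t => monomial 0 (V t) * R.damping V t) (Ioi 0) := by
    refine integrableOn_Ioi_of_intervalIntegral_norm_bounded C 0 (l := atTop) (b := id)
      (fun T => (hV.continuous_integrand 0).integrableOn_Ioc) tendsto_id ?_
    filter_upwards [eventually_ge_atTop T₀] with T hT
    refine (le_of_eq ?_).trans (h T hT)
    exact intervalIntegral.integral_congr fun t _ =>
      Real.norm_of_nonneg (hV.integrand_nonneg 0 t)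
  exact (integrableOn_Ici_iff_integrableOn_Ioi enorm_ne_top).2 this

lemma flowLIntegral_eq (hV : R.IsFlow V) (h : R.flowLIntegral V 0 ≠ ⊤) (i : Fin n → ℕ) :
    R.flowLIntegral V i
      = ENNReal.ofReal (∫ t in Ioi 0, monomial i (V t) * R.damping V t) := by
  rw [← integral_Ici_eq_integral_Ioi, ofReal_integral_eq_lintegral_ofReal
    (hV.integrableOn_of_flowLIntegral_ne_top h i) (Eventually.of_forall (hV.integrand_nonneg i))]
  rfl

/-- The extinction probabilities when the integral along the flow is finite. -/
theorem extinction_eq_div (hV : R.IsFlow V) (h : R.flowLIntegral V 0 ≠ ⊤) (i : Fin n → ℕ) :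
    R.extinction i = R.flowLIntegral V i / R.flowLIntegral V 0 := by
  set κ : (Fin n → ℕ) → ℝ := fun j => ∫ t in Ioi 0, monomial j (V t) * R.damping V t
  have hlim : ∀ j, Tendsto (fun T => R.flowIntegral V T j) atTop (𝓝 (κ j)) := fun j =>
    intervalIntegral_tendsto_integral_Ioi 0
      ((integrableOn_Ici_iff_integrableOn_Ioi enorm_ne_top).1
        (hV.integrableOn_of_flowLIntegral_ne_top h j))
      tendsto_id
  have hκ0 : 0 < κ 0 := by
    have := hV.flowLIntegral_zero_pos
    rwa [hV.flowLIntegral_eq h, ENNReal.ofReal_pos] at this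
  have hκnn : ∀ j, 0 ≤ κ j := fun j => ge_of_tendsto (hlim j) (by
    filter_upwards [eventually_ge_atTop 0] with T hT using hV.flowIntegral_nonneg hT j)
  have hKle : ∀ T, 0 ≤ T → R.flowIntegral V T 0 ≤ κ 0 := by
    intro T hT
    refine ge_of_tendsto (hlim 0) ?_
    filter_upwards [eventually_ge_atTop T] with S hS
    exact intervalIntegral.integral_mono_interval le_rfl hT hS
      (Eventually.of_forall (hV.integrand_nonneg 0))
      ((hV.continuous_integrand 0).intervalIntegrable _ _)
  -- A decreasing function with finite integral: `T` times its value at `T` is at most the whole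
  -- integral.
  have hE : Tendsto (R.damping V) atTop (𝓝 0) := by
    refine squeeze_zero' (Eventually.of_forall fun t => (damping_pos t).le) (g := fun T => κ 0 / T)
      ?_ (tendsto_const_nhds.div_atTop tendsto_id)
    filter_upwards [eventually_gt_atTop 0] with T hT
    rw [le_div_iff₀ hT]
    refine le_trans ?_ (hKle T hT.le)
    have h1 : R.damping V T * T = ∫ _ in (0 : ℝ)..T, R.damping V T := by simp [mul_comm]
    rw [h1]
    refine intervalIntegral.integral_mono_on hT.le (by simp)
      ((hV.continuous_integrand 0).intervalIntegrable _ _) fun t ht => ?_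
    rw [monomial_zero_left, one_mul]
    exact hV.antitone_damping ht.2
  -- The boundary term is at most `E(T)` and vanishes in the limit, so the subsolutions become an
  -- exact solution.
  have hsum : ∀ i, i ≠ 0 → HasSum (fun j => R.qMatrix i j * κ j) 0 := by
    intro i hi
    have hs : Summable fun j => R.qMatrix i j * κ j := by
      refine R.summable_qMatrix_mul hi (C := κ 0) fun j => ?_
      rw [abs_of_nonneg (hκnn j)]
      refine le_of_tendsto_of_tendsto (hlim j) (hlim 0) ?_
      filter_upwards [eventually_ge_atTop 0] with T hT
        using hV.flowIntegral_le_flowIntegral_zero hT j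
    have h1 : Tendsto (fun T => ∑' j, R.qMatrix i j * R.flowIntegral V T j) atTop
        (𝓝 (∑' j, R.qMatrix i j * κ j)) := by
      refine tendsto_tsum_of_dominated_convergence (bound := fun j => |R.qMatrix i j| * κ 0)
        ((R.hasSum_qMatrix hi).summable.abs.mul_right _) (fun j => (hlim j).const_mul _) ?_
      filter_upwards [eventually_ge_atTop 0] with T hT j
      rw [norm_mul, Real.norm_eq_abs, Real.norm_of_nonneg (hV.flowIntegral_nonneg hT j)]
      exact mul_le_mul_of_nonneg_left
        ((hV.flowIntegral_le_flowIntegral_zero hT j).trans (hKle T hT)) (abs_nonneg _)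
    have h2 : Tendsto (fun T => ∑' j, R.qMatrix i j * R.flowIntegral V T j) atTop (𝓝 0) := by
      refine squeeze_zero' (g := R.damping V) ?_ ?_ hE
      · filter_upwards [eventually_ge_atTop 0] with T hT
        rw [(hV.hasSum_qMatrix_mul_flowIntegral hi hT).tsum_eq]
        exact hV.integrand_nonneg i T
      · filter_upwards [eventually_ge_atTop 0] with T hT
        rw [(hV.hasSum_qMatrix_mul_flowIntegral hi hT).tsum_eq]
        exact mul_le_of_le_one_left (damping_pos T).le (monomial_le_one i (hV.mem T))
    rw [← tendsto_nhds_unique h1 h2]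
    exact hs.hasSum
  rw [hV.flowLIntegral_eq h, hV.flowLIntegral_eq h, ← ENNReal.ofReal_div_of_pos hκ0]
  refine le_antisymm (R.extinction_le_ofReal (x := fun j => κ j / κ 0)
    (fun j => div_nonneg (hκnn j) hκ0.le) (div_self hκ0.ne').ge (fun i hi => ⟨0, le_rfl, ?_⟩) i) ?_
  · have := (hsum i hi).div_const (κ 0)
    rw [zero_div] at this
    exact this.congr_fun fun j => by ring
  · refine ENNReal.ofReal_le_of_le_toReal ?_
    refine le_of_tendsto ((hlim i).div (hlim 0) hκ0.ne') ?_
    filter_upwards [eventually_gt_atTop 0] with T hT using hV.flowIntegral_div_le_extinction hT i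

/-- Extinction is certain if the flow converges to `1` and the integral along it is infinite. -/
theorem extinction_eq_one (hV : R.IsFlow V) (hlim : Tendsto V atTop (𝓝 1))
    (h : R.flowLIntegral V 0 = ⊤) (i : Fin n → ℕ) : R.extinction i = 1 := by
  by_contra hne
  set a := (R.extinction i).toReal
  have ha : a < 1 := by
    rw [← ENNReal.toReal_one]
    exact (ENNReal.toReal_lt_toReal (R.extinction_ne_top i) ENNReal.one_ne_top).2
      (lt_of_le_of_ne (R.extinction_le_one i) hne)
  -- Any `r` strictly between `a` and `1` works. Once `V^i > r`, comparing `r (K_T(0) - K_{T₀}(0)) ≤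
  -- K_T(i) ≤ a K_T(0)` bounds `K_T(0)` uniformly, against divergence.
  set r := (1 + a) / 2
  have hr : a < r ∧ r < 1 := ⟨by simp only [r]; linarith, by simp only [r]; linarith⟩
  have h1 : Tendsto (fun t => monomial i (V t)) atTop (𝓝 1) := by
    have := ((continuous_monomial i).tendsto 1).comp hlim
    rwa [monomial_one_right] at this
  obtain ⟨T₀, hT₀⟩ := eventually_atTop.1 ((h1.eventually_const_lt hr.2).and
    (eventually_gt_atTop 0))
  have hT₀pos := (hT₀ T₀ le_rfl).2
  have hii : ∀ j x y, IntervalIntegrable (fun t => monomial j (V t) * R.damping V t) volume x y :=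
    fun j x y => (hV.continuous_integrand j).intervalIntegrable x y
  refine hV.flowLIntegral_ne_top (T₀ := T₀) (C := r * R.flowIntegral V T₀ 0 / (r - a))
    (fun T hT => ?_) h
  rw [le_div_iff₀ (by linarith [hr.1])]
  have hTpos := hT₀pos.trans_le hT
  have h2 := hV.flowIntegral_div_le_extinction hTpos i
  rw [div_le_iff₀ (hV.flowIntegral_zero_pos hTpos)] at h2
  have h3 : r * (R.flowIntegral V T 0 - R.flowIntegral V T₀ 0) ≤ R.flowIntegral V T i := by
    have e0 : R.flowIntegral V T 0 - R.flowIntegral V T₀ 0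
        = ∫ t in T₀..T, monomial 0 (V t) * R.damping V t :=
      intervalIntegral.integral_interval_sub_left (hii 0 _ _) (hii 0 _ _)
    have e1 : R.flowIntegral V T i = R.flowIntegral V T₀ i +
        ∫ t in T₀..T, monomial i (V t) * R.damping V t :=
      (intervalIntegral.integral_add_adjacent_intervals (hii i _ _) (hii i _ _)).symm
    rw [e0, e1, ← intervalIntegral.integral_const_mul]
    refine le_add_of_nonneg_of_le (hV.flowIntegral_nonneg hT₀pos.le i) ?_
    refine intervalIntegral.integral_mono_on hT ((hii 0 _ _).const_mul r) (hii i _ _) fun t ht => ?_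
    rw [monomial_zero_left, one_mul]
    exact mul_le_mul_of_nonneg_right (hT₀ t ht.1).1.le (damping_pos t).le
  linarith

/-- Since `A(V) ≤ A(q) < 0`, integrating `E' = E A(V)` bounds `-A(q) ∫ E` by `1`. -/
lemma flowLIntegral_ne_top_of_lt_one (hV : R.IsFlow V) {q : Fin n → ℝ}
    (hq : ∀ k, q k < 1) (hle : ∀ t, V t ≤ q) : R.flowLIntegral V 0 ≠ ⊤ := by
  have hq0 : 0 ≤ q := (hV.mem 0).1.trans (hle 0)
  have hA : 0 < -R.A q := neg_pos.2 (R.A_neg hq0 hq)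
  refine hV.flowLIntegral_ne_top (T₀ := 0) (C := 1 / -R.A q) fun T hT => ?_
  rw [le_div_iff₀ hA]
  have hc : Continuous fun t => R.damping V t * R.A (V t) :=
    hV.continuous_damping.mul (hV.continuous_comp R.continuousOn_A)
  have h1 := intervalIntegral.integral_eq_sub_of_hasDerivAt (a := 0) (b := T)
    (fun t _ => hV.hasDerivAt_damping t) (hc.intervalIntegrable _ _)
  rw [damping_zero] at h1
  have h2 : R.flowIntegral V T 0 * -R.A q ≤ ∫ t in (0 : ℝ)..T, -(R.damping V t * R.A (V t)) := by
    rw [flowIntegral, ← intervalIntegral.integral_mul_const]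
    refine intervalIntegral.integral_mono_on hT
      (((hV.continuous_integrand 0).mul continuous_const).intervalIntegrable _ _)
      (hc.neg.intervalIntegrable _ _) fun t _ => ?_
    rw [monomial_zero_left, one_mul, ← mul_neg]
    exact mul_le_mul_of_nonneg_left
      (neg_le_neg (R.A_mono (hV.mem t).1 (hle t) fun k => (hq k).le)) (damping_pos t).le
  rw [intervalIntegral.integral_neg, h1] at h2
  linarith [damping_pos (R := R) (V := V) T]

lemma flowLIntegral_le (hV : R.IsFlow V) {q : Fin n → ℝ} (hle : ∀ t, V t ≤ q) (i : Fin n → ℕ) :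
    R.flowLIntegral V i ≤ ENNReal.ofReal (monomial i q) * R.flowLIntegral V 0 := by
  have hq0 : 0 ≤ q := (hV.mem 0).1.trans (hle 0)
  rw [flowLIntegral, flowLIntegral, ← lintegral_const_mul _
    (hV.continuous_integrand 0).measurable.ennreal_ofReal]
  refine lintegral_mono fun t => ?_
  rw [← ENNReal.ofReal_mul (monomial_nonneg i hq0), monomial_zero_left, one_mul]
  exact ENNReal.ofReal_le_ofReal (mul_le_mul_of_nonneg_right
    (monomial_mono i (hV.mem t).1 (hle t)) (damping_pos t).le)

/-- A zero satisfies `N_k(q) = β_k q_k`; inserting this in `le_N_mul` gives `V_k ≤ q_k (1 - exp(-β_k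
t))`. -/
lemma lt_of_B_eq_zero (hV : R.IsFlow V) {q : Fin n → ℝ} (hq : q ∈ Icc (0 : Fin n → ℝ) 1)
    (hle : ∀ t, V t ≤ q) {k : Fin n} (hB : R.B k q = 0) (hk : 0 < q k) (t : ℝ) :
    V t k < q k := by
  rcases le_total t 0 with ht | ht
  · rw [hV.eq_zero t ht]; exact hk
  · have h1 := hV.le_N_mul ht k
    have h2 := R.N_mono k (hV.mem t).1 (hle t) hq.2
    rw [R.B_eq k hq] at hB
    have h3 := Real.exp_pos (-R.beta k * t)
    have h4 : Real.exp (-R.beta k * t) ≤ 1 :=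
      Real.exp_le_one_iff.2 (by nlinarith [R.beta_pos k])
    have h6 := mul_pos (R.beta_pos k) hk
    have h5 : R.beta k * V t k < R.beta k * q k := by
      have := mul_le_mul_of_nonneg_right h2 (sub_nonneg.2 h4)
      nlinarith [mul_pos h6 h3]
    exact lt_of_mul_lt_mul_left h5 (R.beta_pos k).le

lemma flowLIntegral_lt (hV : R.IsFlow V) {q : Fin n → ℝ} (hq : q ∈ R.zeros)
    (hle : ∀ t, V t ≤ q) (h : R.flowLIntegral V 0 ≠ ⊤) {i : Fin n → ℕ} (hi : i ≠ 0)
    (hpos : 0 < monomial i q) :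
    R.flowLIntegral V i < ENNReal.ofReal (monomial i q) * R.flowLIntegral V 0 := by
  have hfin : R.flowLIntegral V i ≠ ⊤ := by
    rw [hV.flowLIntegral_eq h]; exact ENNReal.ofReal_ne_top
  rw [flowLIntegral] at hfin
  rw [flowLIntegral, flowLIntegral, ← lintegral_const_mul _
    (hV.continuous_integrand 0).measurable.ennreal_ofReal]
  refine lintegral_strict_mono ?_
    (Measurable.const_mul (hV.continuous_integrand 0).measurable.ennreal_ofReal _).aemeasurable
    hfin (Eventually.of_forall fun t => ?_)
  · simp [Measure.restrict_eq_zero]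
  · rw [← ENNReal.ofReal_mul hpos.le, monomial_zero_left, one_mul,
      ENNReal.ofReal_lt_ofReal_iff (mul_pos hpos (damping_pos t))]
    exact mul_lt_mul_of_pos_right (monomial_lt hi (hV.mem t).1 (hle t)
      (fun k hk => hV.lt_of_B_eq_zero hq.1 hle (hq.2 k) hk t) hpos) (damping_pos t)

end IsFlow

end Rates

namespace Rates

variable {n : ℕ} [NeZero n] {R : Rates n}

/-! ### Uniqueness of the curve -/

namespace IsCurve

variable {r : ℝ} {c : ℝ → Fin n → ℝ}

lemma apply_zero (hc : R.IsCurve r c) (hr : 0 ≤ r) : c 0 = 0 := by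
  funext k
  by_cases hk : k = 0
  · subst hk; exact hc.first 0 ⟨le_rfl, hr⟩
  · exact hc.initial k hk

lemma continuousOn_comp (hc : R.IsCurve r c) {f : (Fin n → ℝ) → ℝ}
    (hf : ContinuousOn f (Icc 0 1)) : ContinuousOn (fun u => f (c u)) (Icc 0 r) :=
  hf.comp hc.continuousOn hc.mem_cube

/-- A continuous function without zeros that starts at `B_1(0) > 0` keeps its sign. -/
lemma B_zero_pos (hc : R.IsCurve r c) (hB : 0 < R.B 0 0) {u : ℝ} (hu : u ∈ Ico 0 r) :
    0 < R.B 0 (c u) := by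
  by_contra! hneg
  have hr : 0 ≤ r := hu.1.trans hu.2.le
  have hcont : ContinuousOn (fun u => R.B 0 (c u)) (Icc 0 u) :=
    (hc.continuousOn_comp (R.continuousOn_B 0)).mono (Icc_subset_Icc_right hu.2.le)
  obtain ⟨v, hv, hv0⟩ := intermediate_value_Icc' hu.1 hcont
    (show (0 : ℝ) ∈ Icc (R.B 0 (c u)) (R.B 0 (c 0)) from
      ⟨hneg, by rw [hc.apply_zero hr]; exact hB.le⟩)
  exact hc.ne_zero v ⟨hv.1, hv.2.trans_lt hu.2⟩ hv0

/-- The first coordinate has derivative `1 = B_1 / B_1`, so the whole curve solves one autonomous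
system. -/
lemma hasDerivWithinAt (hc : R.IsCurve r c) {u : ℝ} (hu : u ∈ Ico 0 r) :
    HasDerivWithinAt c (fun k => R.B k (c u) / R.B 0 (c u)) (Ici u) u := by
  refine HasDerivWithinAt.mono_of_mem_nhdsWithin (t := Icc 0 r) ?_
    (mem_of_superset (Icc_mem_nhdsGE hu.2) (Icc_subset_Icc_left hu.1))
  refine hasDerivWithinAt_pi.2 fun k => ?_
  by_cases hk : k = 0
  · subst hk
    rw [div_self (hc.ne_zero u hu)]
    exact (hasDerivWithinAt_id u _).congr (fun v hv => hc.first v hv)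
      (hc.first u (Ico_subset_Icc_self hu))
  · exact hc.ode u hu k hk

end IsCurve

lemma lipschitzOnWith_div (hA2 : R.FiniteMeans) {δ : ℝ} (hδ : 0 < δ) :
    ∃ K, LipschitzOnWith K (fun (y : Fin n → ℝ) k => R.B k y / R.B 0 y)
      {y | y ∈ Icc (0 : Fin n → ℝ) 1 ∧ δ ≤ R.B 0 y} := by
  obtain ⟨L, hL, hlip⟩ := hA2.lipschitz
  have hK : 0 ≤ L / δ + L * L / (δ * δ) := by positivity
  refine ⟨(L / δ + L * L / (δ * δ)).toNNReal, LipschitzOnWith.of_dist_le_mul fun x hx y hy => ?_⟩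
  rw [Real.coe_toNNReal _ hK]
  rw [dist_pi_le_iff (mul_nonneg hK dist_nonneg)]
  intro k
  have hx0 : 0 < R.B 0 x := hδ.trans_le hx.2
  have hy0 : 0 < R.B 0 y := hδ.trans_le hy.2
  have hbound : |R.B k y| ≤ L := by
    have h1 := hlip k y hy.1 1 ⟨zero_le_one, le_rfl⟩
    rw [R.B_one, sub_zero] at h1
    refine h1.trans (mul_le_of_le_one_right hL ?_)
    refine (pi_norm_le_iff_of_nonneg zero_le_one).2 fun l => ?_
    have h2 := hy.1.1 l
    have h3 := hy.1.2 l
    simp only [Pi.zero_apply, Pi.one_apply] at h2 h3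
    rw [Pi.sub_apply, Pi.one_apply, Real.norm_eq_abs, abs_le]
    constructor <;> linarith
  have h1 := hlip k x hx.1 y hy.1
  have h2 := hlip 0 x hx.1 y hy.1
  rw [Real.dist_eq, dist_eq_norm]
  change _ ≤ (L / δ + L * L / (δ * δ)) * ‖x - y‖
  have e : R.B k x / R.B 0 x - R.B k y / R.B 0 y = (R.B k x - R.B k y) / R.B 0 x +
      R.B k y * -(R.B 0 x - R.B 0 y) / (R.B 0 x * R.B 0 y) := by
    field_simp
    ring
  rw [e, add_mul]
  refine (abs_add_le _ _).trans (add_le_add ?_ ?_)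
  · rw [abs_div, abs_of_pos hx0, div_mul_eq_mul_div]
    exact div_le_div₀ (mul_nonneg hL (norm_nonneg _)) h1 hδ hx.2
  · rw [abs_div, abs_mul, abs_neg, abs_of_pos (mul_pos hx0 hy0), div_mul_eq_mul_div, mul_assoc]
    refine div_le_div₀ (by positivity) (mul_le_mul hbound h2 (abs_nonneg _) hL) (by positivity) ?_
    exact mul_le_mul hx.2 hy.2 hδ.le hx0.le

theorem IsCurve.eqOn (hA2 : R.FiniteMeans) (hB : 0 < R.B 0 0) {r : ℝ} (hr : 0 < r)
    {c c' : ℝ → Fin n → ℝ} (hc : R.IsCurve r c) (hc' : R.IsCurve r c') :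
    EqOn c c' (Icc 0 r) := by
  -- The denominator may vanish at the endpoint `r`. On `[0, b]` with `b < r` it is bounded below
  -- along both curves, which gives a Lipschitz field; the endpoint follows by continuity.
  refine Set.EqOn.of_subset_closure (s := Ico 0 r) (fun b hb => ?_) hc.continuousOn
    hc'.continuousOn Ico_subset_Icc_self (closure_Ico hr.ne).symm.subset
  have hsub : Icc 0 b ⊆ Ico 0 r := fun u hu => ⟨hu.1, hu.2.trans_lt hb.2⟩
  have hδ : ∀ c, R.IsCurve r c → ∃ δ > 0, ∀ u ∈ Icc 0 b, δ ≤ R.B 0 (c u) := by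
    intro c hc
    obtain ⟨u, hu, hmin⟩ := isCompact_Icc.exists_isMinOn (nonempty_Icc.2 hb.1)
      ((hc.continuousOn_comp (R.continuousOn_B 0)).mono (hsub.trans Ico_subset_Icc_self))
    exact ⟨_, hc.B_zero_pos hB (hsub hu), fun v hv => hmin hv⟩
  obtain ⟨δ, hδ0, h1⟩ := hδ c hc
  obtain ⟨δ', hδ0', h1'⟩ := hδ c' hc'
  obtain ⟨K, hK⟩ := lipschitzOnWith_div hA2 (lt_min hδ0 hδ0')
  refine ODE_solution_unique_of_mem_Icc_right (a := 0) (b := b) (K := K)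
    (v := fun _ y k => R.B k y / R.B 0 y)
    (s := fun _ => {y | y ∈ Icc (0 : Fin n → ℝ) 1 ∧ min δ δ' ≤ R.B 0 y}) (fun _ _ => hK)
    (hc.continuousOn.mono (hsub.trans Ico_subset_Icc_self))
    (fun t ht => hc.hasDerivWithinAt (hsub (Ico_subset_Icc_self ht)))
    (fun t ht => ⟨hc.mem_cube t (Ico_subset_Icc_self (hsub (Ico_subset_Icc_self ht))),
      (min_le_left _ _).trans (h1 t (Ico_subset_Icc_self ht))⟩)
    (hc'.continuousOn.mono (hsub.trans Ico_subset_Icc_self))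
    (fun t ht => hc'.hasDerivWithinAt (hsub (Ico_subset_Icc_self ht)))
    (fun t ht => ⟨hc'.mem_cube t (Ico_subset_Icc_self (hsub (Ico_subset_Icc_self ht))),
      (min_le_right _ _).trans (h1' t (Ico_subset_Icc_self ht))⟩) ?_ ⟨hb.1, le_rfl⟩
  rw [hc.apply_zero hr.le, hc'.apply_zero hr.le]

/-! ### Existence of the curve -/

namespace IsFlow

variable {V : ℝ → Fin n → ℝ}

/-- For `t ≤ 0` the flow is zero and the extension nonpositive, so the speed is at least `B_1(0)`.
-/
lemma deriv_extend_pos (hV : R.IsFlow V) (hB : 0 < R.B 0 0) (t : ℝ) :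
    0 < R.N 0 (V t) - R.beta 0 * extend R V t 0 := by
  rcases le_total 0 t with ht | ht
  · rw [hV.extend_eq ht, ← R.B_eq 0 (hV.mem t)]
    exact hV.B_zero_pos hB ht
  · have h1 : extend R V t 0 ≤ 0 := by
      refine mul_nonpos_of_nonneg_of_nonpos (Real.exp_pos _).le ?_
      rw [intervalIntegral.integral_symm, neg_nonpos]
      exact intervalIntegral.integral_nonneg ht fun s _ =>
        mul_nonneg (Real.exp_pos _).le (R.N_nonneg 0 (hV.mem s).1)
    rw [hV.eq_zero t ht, R.N_zero]
    nlinarith [R.beta_pos 0]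

lemma strictMono_extend (hV : R.IsFlow V) (hB : 0 < R.B 0 0) :
    StrictMono fun t => extend R V t 0 :=
  strictMono_of_hasDerivAt_pos (fun t => hV.hasDerivAt_extend t 0) (hV.deriv_extend_pos hB)

lemma strictMonoOn_zero (hV : R.IsFlow V) (hB : 0 < R.B 0 0) :
    StrictMonoOn (fun t => V t 0) (Ici 0) := by
  intro s hs t ht hst
  have := hV.strictMono_extend hB hst
  simp only [hV.extend_eq hs, hV.extend_eq ht] at this
  exact this

/-- The flow, parametrized by its first component, and continued by its limit point `q`. -/
def curve (R : Rates n) (V : ℝ → Fin n → ℝ) (q : Fin n → ℝ) (u : ℝ) : Fin n → ℝ :=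
  if u < q 0 then extend R V (Function.invFun (fun t => extend R V t 0) u) else q

variable {q : Fin n → ℝ}

lemma apply_zero_lt (hV : R.IsFlow V) (hB : 0 < R.B 0 0) (hle : ∀ t, V t ≤ q) {t : ℝ}
    (ht : 0 ≤ t) : V t 0 < q 0 :=
  (hV.strictMonoOn_zero hB ht (show 0 ≤ t + 1 by linarith) (lt_add_one t)).trans_le
    (hle (t + 1) 0)

lemma invFun_extend (hV : R.IsFlow V) (hB : 0 < R.B 0 0) (t : ℝ) :
    Function.invFun (fun t => extend R V t 0) (extend R V t 0) = t :=
  Function.leftInverse_invFun (hV.strictMono_extend hB).injective t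

lemma curve_apply (hV : R.IsFlow V) (hB : 0 < R.B 0 0) (hle : ∀ t, V t ≤ q) {t : ℝ}
    (ht : 0 ≤ t) : curve R V q (V t 0) = V t := by
  rw [curve, if_pos (hV.apply_zero_lt hB hle ht), ← hV.extend_eq ht, hV.invFun_extend hB]

lemma curve_self : curve R V q (q 0) = q := by simp [curve]

lemma image_Ici (hV : R.IsFlow V) (hB : 0 < R.B 0 0) (hlim : Tendsto V atTop (𝓝 q))
    (hle : ∀ t, V t ≤ q) : (fun t => V t 0) '' Ici 0 = Ico 0 (q 0) := by
  refine Subset.antisymm ?_ fun u hu => ?_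
  · rintro _ ⟨t, ht, rfl⟩
    exact ⟨(hV.mem t).1 0, hV.apply_zero_lt hB hle ht⟩
  · obtain ⟨T, hT, hT0⟩ := (((tendsto_pi_nhds.1 hlim 0).eventually_const_lt hu.2).and
      (eventually_ge_atTop 0)).exists
    obtain ⟨t, ht, htu⟩ := intermediate_value_Icc hT0
      (((continuous_apply (0 : Fin n)).comp hV.continuous).continuousOn)
      (show u ∈ Icc (V 0 0) (V T 0) from ⟨by rw [hV.eq_zero 0 le_rfl]; exact hu.1, hT.le⟩)
    exact ⟨t, ht.1, htu⟩

/-- The inverse function theorem for the first coordinate. Using the extension to negative times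
makes the derivative two-sided even at `t = 0`. -/
lemma hasDerivAt_curve (hV : R.IsFlow V) (hB : 0 < R.B 0 0) (hle : ∀ t, V t ≤ q) {t : ℝ}
    (ht : 0 ≤ t) (k : Fin n) :
    HasDerivAt (fun u => curve R V q u k) (R.B k (V t) / R.B 0 (V t)) (V t 0) := by
  have hcont : Continuous fun t => R.N 0 (V t) - R.beta 0 * extend R V t 0 :=
    (hV.continuous_comp (R.continuousOn_N 0)).sub
      (continuous_const.mul ((continuous_apply (0 : Fin n)).comp hV.continuous_extend))
  have h1 := (hasStrictDerivAt_of_hasDerivAt_of_continuousAt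
    (Eventually.of_forall fun s => hV.hasDerivAt_extend s 0) hcont.continuousAt (x := t))
  have h2 := (h1.to_local_left_inverse (hV.deriv_extend_pos hB t).ne'
    (Eventually.of_forall (hV.invFun_extend hB))).hasDerivAt
  have h3 : HasDerivAt (fun s => extend R V s k) (R.B k (V t))
      (Function.invFun (fun t => extend R V t 0) (extend R V t 0)) := by
    rw [hV.invFun_extend hB]
    exact hV.hasDerivAt_extend_of_nonneg ht k
  have h4 := h3.comp _ h2
  rw [hV.extend_eq ht, ← R.B_eq 0 (hV.mem t), ← div_eq_mul_inv] at h4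
  refine h4.congr_of_eventuallyEq ?_
  filter_upwards [eventually_lt_nhds (hV.apply_zero_lt hB hle ht)] with u hu
  simp [curve, hu]

lemma isCurve_curve (hV : R.IsFlow V) (hB : 0 < R.B 0 0) (hlim : Tendsto V atTop (𝓝 q))
    (hle : ∀ t, V t ≤ q) (hq : q ∈ Icc (0 : Fin n → ℝ) 1) :
    R.IsCurve (q 0) (curve R V q) := by
  have hex : ∀ u ∈ Ico 0 (q 0), ∃ t, 0 ≤ t ∧ V t 0 = u := fun u hu => by
    rw [← hV.image_Ici hB hlim hle] at hu
    exact hu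
  have hq0 : 0 < q 0 := by
    have := hV.apply_zero_lt hB hle le_rfl
    rwa [hV.eq_zero 0 le_rfl] at this
  have hcases : ∀ u ∈ Icc 0 (q 0), (∃ t, 0 ≤ t ∧ V t 0 = u) ∨ u = q 0 := fun u hu =>
    (lt_or_eq_of_le hu.2).imp_left fun h => hex u ⟨hu.1, h⟩
  refine ⟨?_, ?_, ?_, ?_, ?_, ?_⟩
  · intro u hu
    rcases hcases u hu with ⟨t, ht, rfl⟩ | rfl
    · rw [hV.curve_apply hB hle ht]
    · rw [curve_self]
  · intro u hu
    rcases hcases u hu with ⟨t, ht, rfl⟩ | rfl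
    · rw [hV.curve_apply hB hle ht]; exact hV.mem t
    · rwa [curve_self]
  · intro u hu
    rcases hcases u hu with ⟨t, ht, rfl⟩ | rfl
    · exact (continuousAt_pi.2 fun k =>
        (hV.hasDerivAt_curve hB hle ht k).continuousAt).continuousWithinAt
    -- At the endpoint each component is squeezed between a late value of the increasing flow and
    -- its limit `q k`.
    · refine tendsto_pi_nhds.2 fun k => ?_
      rw [curve_self]
      refine tendsto_order.2 ⟨fun a ha => ?_, fun b hb => ?_⟩
      · obtain ⟨T, hT, hT0⟩ := (((tendsto_pi_nhds.1 hlim k).eventually_const_lt ha).and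
          (eventually_ge_atTop 0)).exists
        filter_upwards [mem_nhdsWithin_of_mem_nhds
          (lt_mem_nhds (hV.apply_zero_lt hB hle hT0)), self_mem_nhdsWithin] with u hu1 hu2
        rcases hcases u hu2 with ⟨t, ht, rfl⟩ | rfl
        · rw [hV.curve_apply hB hle ht]
          refine hT.trans_le (hV.mono ?_ k)
          exact ((hV.strictMonoOn_zero hB).lt_iff_lt hT0 ht).1 hu1 |>.le
        · rwa [curve_self]
      · filter_upwards [self_mem_nhdsWithin] with u hu2
        rcases hcases u hu2 with ⟨t, ht, rfl⟩ | rfl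
        · rw [hV.curve_apply hB hle ht]
          exact (hle t k).trans_lt hb
        · rwa [curve_self]
  · intro k _
    have h := hV.curve_apply hB hle (le_refl 0)
    rw [hV.eq_zero 0 le_rfl] at h
    exact congrFun h k
  · intro u hu
    obtain ⟨t, ht, rfl⟩ := hex u hu
    rw [hV.curve_apply hB hle ht]
    exact (hV.B_zero_pos hB ht).ne'
  · intro u hu k _
    obtain ⟨t, ht, rfl⟩ := hex u hu
    have := (hV.hasDerivAt_curve hB hle ht k).hasDerivWithinAt (s := Icc 0 (q 0))
    rwa [hV.curve_apply hB hle ht]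

/-- The integrals along the curve are integrals along the flow. -/
lemma curveIntegral_eq (hV : R.IsFlow V) (hB : 0 < R.B 0 0) (hlim : Tendsto V atTop (𝓝 q))
    (hle : ∀ t, V t ≤ q) (hq : q ∈ Icc (0 : Fin n → ℝ) 1) (i : Fin n → ℕ) :
    R.curveIntegral (curve R V q) (q 0) i = R.flowLIntegral V i := by
  have hc := hV.isCurve_curve hB hlim hle hq
  set c := curve R V q
  have himg := hV.image_Ici hB hlim hle
  -- Substituting `y = V_1(t)` produces the Jacobian `B_1(V(t))`, which cancels the denominator; the
  -- inner integral is treated in the same way.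
  rw [curveIntegral, ← himg, lintegral_image_eq_lintegral_abs_deriv_mul measurableSet_Ici
    (fun t ht => hV.hasDerivWithinAt ht 0) (hV.strictMonoOn_zero hB).injOn]
  refine setLIntegral_congr_fun measurableSet_Ici fun t ht => ?_
  have ht : 0 ≤ t := ht
  have hint : ∫ x in (0 : ℝ)..V t 0, R.A (c x) / R.B 0 (c x) = ∫ s in (0 : ℝ)..t, R.A (V s) := by
    have hsub : (fun s => V s 0) '' uIcc 0 t ⊆ Ico 0 (q 0) := by
      rw [← himg, uIcc_of_le ht]
      exact image_mono fun s hs => hs.1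
    have h := intervalIntegral.integral_comp_mul_deriv'' (a := 0) (b := t) (f := fun s => V s 0)
      (f' := fun s => R.B 0 (V s)) (g := fun x => R.A (c x) / R.B 0 (c x))
      ((continuous_apply (0 : Fin n)).comp hV.continuous).continuousOn (fun s hs => ?_)
      (hV.continuous_comp (R.continuousOn_B 0)).continuousOn ?_
    · rw [hV.eq_zero 0 le_rfl] at h
      refine h.symm.trans (intervalIntegral.integral_congr fun s hs => ?_)
      rw [uIcc_of_le ht] at hs
      simp only [Function.comp_apply, c]
      rw [hV.curve_apply hB hle hs.1, div_mul_cancel₀ _ (hV.B_zero_pos hB hs.1).ne']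
    · rw [min_eq_left ht] at hs
      exact (hV.hasDerivAt hs.1 0).hasDerivWithinAt
    · refine (((hc.continuousOn_comp R.continuousOn_A).mono Ico_subset_Icc_self).div
        ((hc.continuousOn_comp (R.continuousOn_B 0)).mono Ico_subset_Icc_self)
        hc.ne_zero).mono hsub
  have hpos := hV.B_zero_pos hB ht
  rw [hint, ← ENNReal.ofReal_mul (abs_nonneg _), abs_of_pos hpos, damping]
  simp only [c]
  rw [hV.curve_apply hB hle ht]
  congr 1
  field_simp

end IsFlow

/-! ### Positivity of the smallest zero -/

/-- Types with `q z = 0` cannot disappear: vanishing of `B_l` at `q` forces every possible offspring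
vector of such a type to contain another one. Irreducibility leads from `e_k` to a single particle
of the first type, giving `q 0 = 0`, which contradicts `B_1(0) > 0`. -/
lemma pos_of_irreducible {q : Fin n → ℝ} (hq : q ∈ R.zeros) (hB : 0 < R.B 0 0)
    (hirr : R.NonzeroStatesIrreducible) (k : Fin n) : 0 < q k := by
  have hq0 : ∀ l, 0 ≤ q l := hq.1.1
  have hzero : ∀ l, q l = 0 → ∀ m, 0 < R.b l m → ∃ z, q z = 0 ∧ m z ≠ 0 := by
    intro l hl m hm
    have hme : m ≠ Pi.single l 1 := by
      rintro rfl
      linarith [R.b_pos l]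
    have h1 : R.N l q = 0 := by
      have := R.B_eq l hq.1
      rw [hq.2 l, hl] at this
      linarith
    have h2 := (summable_mul_monomial (R.hasSum_bOff l).summable hq.1).hasSum
    rw [show ∑' m, R.bOff l m * monomial m q = 0 from h1] at h2
    have h3 := congrFun ((hasSum_zero_iff_of_nonneg fun m =>
      mul_nonneg (R.bOff_nonneg l m) (monomial_nonneg m hq0)).1 h2) m
    have h4 : R.bOff l m = R.b l m := by simp [bOff, hme]
    simp only [h4, Pi.zero_apply, mul_eq_zero, hm.ne', false_or] at h3
    obtain ⟨z, -, hz⟩ := Finset.prod_eq_zero_iff.1 h3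
    exact ⟨z, eq_zero_of_pow_eq_zero hz, fun h0 => by simp [h0] at hz⟩
  have hstep : ∀ i j : Fin n → ℕ, 0 < R.qMatrix i j → (∃ z, q z = 0 ∧ i z ≠ 0) →
      ∃ z, q z = 0 ∧ j z ≠ 0 := by
    rintro i j hij ⟨z, hz, hiz⟩
    have hi : i ≠ 0 := fun h => hiz (by simp [h])
    -- If no count drops, the particle of type `z` survives. Otherwise the jump is a branching of
    -- some type `l`: either `q l = 0` and the offspring contain a zero type, or `l ≠ z` and the
    -- particle of type `z` is untouched.
    by_cases hle : i ≤ j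
    · exact ⟨z, hz, fun h => hiz (Nat.le_zero.1 (h ▸ hle z))⟩
    simp only [qMatrix, hi, hle, if_false, add_zero] at hij
    obtain ⟨l, hl⟩ := not_forall.1 fun h => hij.not_ge (Finset.sum_nonpos fun l _ => h l)
    rw [not_le] at hl
    rcases mul_pos_iff.1 hl with ⟨hil, hb⟩ | ⟨hil, -⟩
    · split_ifs at hb with hlj
      · have hil : 0 < i l := Nat.cast_pos.1 hil
        by_cases hql : q l = 0
        · obtain ⟨w, hw, hmw⟩ := hzero l hql _ hb
          refine ⟨w, hw, fun h0 => ?_⟩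
          simp only [Pi.sub_apply, Pi.add_apply, h0, zero_add] at hmw
          by_cases hwl : w = l
          · subst hwl
            simp only [Pi.single_eq_same] at hmw
            omega
          · simp [hwl] at hmw
        · have hzl : z ≠ l := fun h => hql (h ▸ hz)
          refine ⟨z, hz, fun h0 => hiz ?_⟩
          have := hlj z
          simpa [h0, hzl] using this
      · exact absurd hb (lt_irrefl _)
    · exact absurd hil (Nat.cast_nonneg _).not_gt
  by_contra! hk
  have hk0 : q k = 0 := le_antisymm hk (hq0 k)
  have hne : ∀ l : Fin n, (Pi.single l 1 : Fin n → ℕ) ≠ 0 := fun l h => by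
    simpa using congrFun h l
  have hreach : ∀ j, Relation.ReflTransGen (fun x y => 0 < R.qMatrix x y) (Pi.single k 1) j →
      ∃ z, q z = 0 ∧ j z ≠ 0 := by
    intro j hj
    induction hj with
    | refl => exact ⟨k, hk0, by simp⟩
    | tail _ h ih => exact hstep _ _ h ih
  obtain ⟨z, hz, hz1⟩ := hreach _ (hirr _ (Pi.single 0 1) (hne k) (hne 0))
  obtain rfl : z = 0 := by
    by_contra h
    simp [h] at hz1
  have h1 := R.N_mono 0 le_rfl hq.1.1 hq.1.2
  have h2 := R.B_eq 0 hq.1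
  rw [hq.2 0, hz] at h2
  rw [R.N_zero] at h1
  linarith

end Rates

end

end NTBIP

/-! ### The extinction criterion and formulas -/

theorem theorem3p2 (n : ℕ) [NeZero n] (R : NTBIP.Rates n)
    (hA1 : ¬ R.Singular) (hA2 : R.FiniteMeans) (hA3 : (R.meanMatrix 1).IsPrimitive)
    (hB : 0 < R.B 0 0) :
    ∃ (q : Fin n → ℝ) (c : ℝ → Fin n → ℝ) (a : (Fin n → ℕ) → ENNReal),
      -- `q` is the smallest zero, `c` the unique curve, `a i` the extinction probability from `i`
      IsLeast R.zeros q ∧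
      (R.IsCurve (q 0) c ∧ ∀ c', R.IsCurve (q 0) c' → Set.EqOn c' c (Set.Icc 0 (q 0))) ∧
      (∀ i, Filter.Tendsto (fun t : ℝ => NTBIP.fellerMinimal R.qMatrix t i 0) Filter.atTop
        (nhds (a i))) ∧
      -- the criterion
      (∀ i, i ≠ 0 → (a i = 1 ↔ R.rho 1 ≤ 0 ∧ R.J c = ⊤)) ∧
      -- (i)
      (R.rho 1 ≤ 0 → q = 1) ∧
      (R.rho 1 ≤ 0 → R.J c = ⊤ → ∀ i, i ≠ 0 → a i = 1) ∧
      -- (ii)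
      (R.rho 1 ≤ 0 → R.J c < ⊤ → ∀ i, i ≠ 0 →
        a i = R.curveIntegral c 1 i / R.curveIntegral c 1 0 ∧ a i < 1) ∧
      -- (iii)
      (0 < R.rho 1 →
        c (q 0) = q ∧ (∀ k, q k < 1) ∧ (R.NonzeroStatesIrreducible → ∀ k, 0 < q k) ∧
        R.curveIntegral c (q 0) 0 < ⊤ ∧
        ∀ i, i ≠ 0 →
          a i = R.curveIntegral c (q 0) i / R.curveIntegral c (q 0) 0 ∧
          a i ≤ ENNReal.ofReal (NTBIP.monomial i q) ∧
          (0 < NTBIP.monomial i q → a i < ENNReal.ofReal (NTBIP.monomial i q)) ∧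
          NTBIP.monomial i q < 1) := by
  obtain ⟨V, hV⟩ := R.exists_isFlow
  obtain ⟨q, hq, hlim, hmin⟩ := hV.exists_isLeast_zeros
  have hle : ∀ t, V t ≤ q := fun t => hV.mono.ge_of_tendsto hlim t
  have hqc : q ∈ Icc (0 : Fin n → ℝ) 1 := hq.1.1
  have hcurve := hV.isCurve_curve hB hlim hle hqc
  have hq0 : 0 < q 0 := by
    have := hV.apply_zero_lt hB hle le_rfl
    rwa [hV.eq_zero 0 le_rfl] at this
  set c := NTBIP.Rates.IsFlow.curve R V q
  have hI : ∀ i, R.curveIntegral c (q 0) i = R.flowLIntegral V i :=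
    hV.curveIntegral_eq hB hlim hle hqc
  have hone : R.rho 1 ≤ 0 → q = 1 := fun h =>
    NTBIP.Rates.eq_one_of_rho_nonpos hA2 hA3 hB h hq.1
  have hI1 : R.rho 1 ≤ 0 → ∀ i, R.curveIntegral c 1 i = R.flowLIntegral V i := by
    intro h i
    rw [← hI, hone h]
    rfl
  have hpos : R.flowLIntegral V 0 ≠ 0 := hV.flowLIntegral_zero_pos.ne'
  have hlt : ∀ i, i ≠ 0 → R.flowLIntegral V 0 ≠ ⊤ → 0 < NTBIP.monomial i q →
      R.extinction i < ENNReal.ofReal (NTBIP.monomial i q) := by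
    intro i hi h hm
    rw [hV.extinction_eq_div h]
    exact ENNReal.div_lt_of_lt_mul (hV.flowLIntegral_lt hq.1 hle h hi hm)
  have h1 : R.rho 1 ≤ 0 → R.J c = ⊤ → ∀ i, i ≠ 0 → R.extinction i = 1 := by
    intro h hJ i _
    refine hV.extinction_eq_one (hone h ▸ hlim) ?_ i
    rw [← hI1 h]
    exact hJ
  have h2 : R.rho 1 ≤ 0 → R.J c < ⊤ → ∀ i, i ≠ 0 →
      R.extinction i = R.curveIntegral c 1 i / R.curveIntegral c 1 0 ∧ R.extinction i < 1 := by
    intro h hJ i hi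
    have hJ' : R.flowLIntegral V 0 ≠ ⊤ := by
      rw [← hI1 h]
      exact hJ.ne
    -- At `q = 1` the strict monomial bound becomes strict inequality with `1`.
    have hm : NTBIP.monomial i q = 1 := by rw [hone h, NTBIP.monomial_one_right]
    have := hlt i hi hJ' (by rw [hm]; exact one_pos)
    rw [hm, ENNReal.ofReal_one] at this
    exact ⟨by rw [hI1 h, hI1 h, hV.extinction_eq_div hJ'], this⟩
  have h3 : 0 < R.rho 1 → (∀ k, q k < 1) ∧ R.flowLIntegral V 0 ≠ ⊤ := by
    intro h
    obtain ⟨z, hz, hz1, hBz⟩ := NTBIP.Rates.exists_B_neg hA2 hA3 h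
    have hq1 : ∀ k, q k < 1 := fun k => (hmin z hz hBz k).trans_lt (hz1 k)
    exact ⟨hq1, hV.flowLIntegral_ne_top_of_lt_one hq1 hle⟩
  have h4 : ∀ i, R.flowLIntegral V 0 ≠ ⊤ →
      R.extinction i ≤ ENNReal.ofReal (NTBIP.monomial i q) := by
    intro i h
    rw [hV.extinction_eq_div h]
    exact ENNReal.div_le_of_le_mul (hV.flowLIntegral_le hle i)
  refine ⟨q, c, R.extinction, hq, ⟨hcurve, fun c' hc' => hc'.eqOn hA2 hB hq0 hcurve⟩,
    NTBIP.tendsto_absorption R.qMatrix_zero, fun i hi => ⟨fun ha => ?_, fun h => h1 h.1 h.2 i hi⟩,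
    hone, h1, h2, fun h => ⟨NTBIP.Rates.IsFlow.curve_self, (h3 h).1, fun hirr =>
      NTBIP.Rates.pos_of_irreducible hq.1 hB hirr, ?_, fun i hi => ⟨?_, h4 i (h3 h).2,
        hlt i hi (h3 h).2, NTBIP.monomial_lt_one hi hqc.1 (h3 h).1⟩⟩⟩
  -- Certain extinction excludes `ρ > 0`, where the probability is at most `q^i < 1`, and then
  -- excludes finite `J`.
  · have hrho : R.rho 1 ≤ 0 := by
      by_contra! hrho
      have h5 := h4 i (h3 hrho).2
      rw [ha, ENNReal.one_le_ofReal] at h5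
      exact h5.not_gt (NTBIP.monomial_lt_one hi hqc.1 (h3 hrho).1)
    refine ⟨hrho, ?_⟩
    by_contra hJ
    exact (h2 hrho (lt_top_iff_ne_top.2 hJ) i hi).2.ne ha
  · rw [hI]
    exact (h3 h).2.lt_top
  · rw [hI, hI, hV.extinction_eq_div (h3 h).2]
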